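/- Let $0<\nu<\tfrac12$ and $\lambda>0$. Let $H_1^{2\nu}$ and $H_2^{\nu}$ be independent stable subordinators of index $2\nu$ and $\nu$, i.e. processes with stationary independent increments, starting at $0$, with nondecreasing right-continuous paths, and $\mathbb E e^{-\mu H_1^{2\nu}(t)}=e^{-t\mu^{2\nu}}$, $\mathbb E e^{-\mu H_2^{\nu}(t)}=e^{-t\mu^{\nu}}$ for $\mu>0$, $t\ge 0$. Put $\mathcal H^\nu(t)=H_1^{2\nu}(t)+(2\lambda)^{1/\nu}H_2^\nu(t)$ and let $$\mathcal L^\nu(t)=\inf\{s>0:\ \mathcal H^\nu(s)\ge t\},\qquad t>0,$$ be the inverse process. Then for every $t>0$ the law of $\mathcal L^\nu(t)$ has a density $\ell_\nu(\cdot,t)$ which is continuous on $[0,\infty)$, and $\ell_\nu$ solves the problem $$\begin{cases}\left(\dfrac{\partial^{2\nu}}{\partial t^{2\nu}}+2\lambda\dfrac{\partial^{\nu}}{\partial t^{\nu}}\right)\ell_\nu(x,t)=-\dfrac{\partial}{\partial x}\ell_\nu(x,t), & x>0,\ t>0,\\[2mm] \ell_\nu(x,0)=\delta(x),\\[1mm]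 \ell_\nu(0,t)=\dfrac{t^{-2\nu}}{\Gamma(1-2\nu)}+2\lambda\dfrac{t^{-\nu}}{\Gamma(1-\nu)}, & t>0.\end{cases}$$ Here $\dfrac{\partial^{\alpha}}{\partial t^{\alpha}}f(t)=\dfrac1{\Gamma(1-\alpha)}\dfrac{d}{dt}\displaystyle\int_0^t\frac{f(s)}{(t-s)^{\alpha}}\,ds$, $0<\alpha<1$, is the Riemann–Liouville derivative, and the initial condition means that $\int_0^\infty\varphi(x)\,\ell_\nu(x,t)\,dx\to\varphi(0)$ as $t\downarrow0$ for every bounded continuous $\varphi:\mathbb R\to\mathbb R$. Moreover, for all $\gamma<\lambda^2$ and $t>0$, $$\int_0^\infty e^{-\gamma x}\ell_\nu(x,t)\,dx=\frac12\left[\left(1+\frac{\lambda}{\sqrt{\lambda^2-\gamma}}\right)E_{\nu,1}(r_1t^\nu)+\left(1-\frac{\lambda}{\sqrt{\lambda^2-\gamma}}\right)E_{\nu,1}(r_2t^\nu)\right],$$ where the integral converges absolutely, $r_1=-\lambda+\sqrt{\lambda^2-\gamma}$, $r_2=-\lambda-\sqrt{\lambda^2-\gamma}$, and $E_{\nu,\psi}(z)=\sum_{k\ge0}\dfrac{z^k}{\Gamma(\nu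 k+\psi)}$ is the Mittag-Leffler function. -/

import Mathlib

open MeasureTheory ProbabilityTheory Filter Topology Set
open scoped NNReal ENNReal BoundedContinuousFunction

noncomputable section

/-- `H` is a (standard) stable subordinator of index `α ∈ (0,1)`: a process with stationary
independent increments, almost surely starting at `0` with nondecreasing right-continuous paths,
and with `𝔼 exp (-μ H(t)) = exp (-t μ ^ α)`. -/
structure IsStableSubordinator {Ω : Type*} [MeasurableSpace Ω] (α : ℝ) (H : ℝ≥0 → Ω → ℝ)
    (P : Measure Ω) : Prop where
  measurable : ∀ t, Measurable (H t)
  indep_increments : HasIndepIncrements H P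
  stationary_increments : ∀ s t : ℝ≥0,
    IdentDistrib (fun ω => H (s + t) ω - H s ω) (H t) P P
  paths : ∀ᵐ ω ∂P, H 0 ω = 0 ∧ (Monotone fun t => H t ω) ∧
    ∀ t, ContinuousWithinAt (fun s => H s ω) (Ici t) t
  laplace : ∀ (t : ℝ≥0) (μ : ℝ), 0 < μ →
    ∫ ω, Real.exp (-μ * H t ω) ∂P = Real.exp (-(t : ℝ) * μ ^ α)

/-- The process `H₁(t) + (2λ)^{1/ν} H₂(t)`. -/
def sumProcess {Ω : Type*} (ν lam : ℝ) (H₁ H₂ : ℝ≥0 → Ω → ℝ) (t : ℝ≥0) (ω : Ω) : ℝ :=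
  H₁ t ω + (2 * lam) ^ (1 / ν) * H₂ t ω

/-- The inverse process `L(t) = inf {s > 0 : H(s) ≥ t}`. -/
def inverseProcess {Ω : Type*} (H : ℝ≥0 → Ω → ℝ) (t : ℝ) (ω : Ω) : ℝ :=
  ((sInf {s : ℝ≥0 | 0 < s ∧ t ≤ H s ω} : ℝ≥0) : ℝ)

/-- The real random variable `X` takes values in `[0,∞)` and has on `[0,∞)` the nonnegative
continuous density `f` with respect to Lebesgue measure. By continuity, `f` is determined by the
law of `X` at every point of `[0,∞)`. -/
def HasContinuousDensity {Ω : Type*} [MeasurableSpace Ω] (X : Ω → ℝ) (f : ℝ → ℝ)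
    (P : Measure Ω) : Prop :=
  ContinuousOn f (Ici 0) ∧ (∀ x, 0 ≤ x → 0 ≤ f x) ∧
    HasLaw X ((volume.restrict (Ici (0 : ℝ))).withDensity fun x => ENNReal.ofReal (f x)) P

/-- The Riemann–Liouville derivative of order `α ∈ (0,1)` (based at `0`) of `f` exists at `t`
and equals `f'`:
`f' = (1 / Γ(1-α)) (d/dt) ∫₀ᵗ f(s) (t-s)^{-α} ds`,
where the integral is absolutely convergent near `t`. -/
def HasRLDerivAt (α : ℝ) (f : ℝ → ℝ) (f' t : ℝ) : Prop :=
  (∀ᶠ τ in 𝓝 t, IntervalIntegrable (fun s => f s * (τ - s) ^ (-α)) volume 0 τ) ∧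
    HasDerivAt
      (fun τ => 1 / Real.Gamma (1 - α) * ∫ s in (0 : ℝ)..τ, f s * (τ - s) ^ (-α)) f' t

/-- The two-parameter Mittag-Leffler function `E_{a,b}(x) = ∑ₖ xᵏ / Γ(a k + b)`. -/
def mittagLeffler (a b x : ℝ) : ℝ :=
  ∑' k : ℕ, x ^ k / Real.Gamma (a * k + b)

end

/-! Write `Ψ(s) = s^(2ν) + 2λ s^ν`, the Laplace exponent of the sum process `H`. In time, the
density must have Laplace transform `Ψ(s) exp(-xΨ(s)) / s`. The proof inverts this transform
explicitly and reads every claim off the inverse.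

Deform the Bromwich contour to the two conjugate rays `arg z = ±θ`. In the coordinate `z = exp w`
the measure `dz / z` becomes `dw`, and conjugation symmetry leaves `1/π` times the imaginary part of
one integral over `w = u + iθ`; this is `rayTransform`. For `θ = π/(1+2ν)` one has `θ > π/2`, so
`exp(tz)` decays on the ray, and `2νθ < π/2`, so `Re Ψ > 0` on the whole sector. All integrals
converge absolutely and can be differentiated under the sign: `∂/∂x` multiplies the kernel by `-Ψ`,
and a fractional derivative of order `α` multiplies it by `z^α`. The equation thus holds already for
the kernels, and at `x = 0` the kernel is a sum of two powers.

That `rayTransform` inverts the Laplace transform (`IsRayAdmissible.laplace_rayTransform`) is shown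
without residues. Subtracting a multiple of a pure power, whose transform is a Gamma integral, makes
the kernel vanish at the pole `z = s`; Cauchy's theorem then moves the remaining integral to the
real axis, where it is real.

Probability enters through `{L(t) ≤ x} = {H(x) ≥ t}`. As functions of `t`, `P(H(x) ≥ t)` and the
primitive in `x` of the candidate density both have transform `(1 - exp(-xΨ(s)))/s`. Uniqueness
(`ae_eq_of_laplace_eq`) gives equality almost everywhere, and monotonicity of one side with
continuity of the other gives it for every `t`. The initial condition is a Chernoff bound. The
transform in `x` comes from the double transform `Ψ / (s(Ψ+γ))`, which partial fractions in `s^ν`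
identify with a Mittag-Leffler mixture; monotonicity of `t ↦ L(t)` again removes the exceptional
null set. -/

/-! ### Uniqueness of the Laplace transform -/

/-- Pull-back of a test function along `y = exp (-t)`. -/
lemma continuous_comp_neg_log_mul_rpow {φ : ℝ → ℝ} (hφ : Continuous φ) (hc : HasCompactSupport φ)
    (h0 : φ 0 = 0) (s : ℝ) : Continuous fun y => φ (-Real.log y) * y ^ (-s) := by
  rw [continuous_iff_continuousAt]
  intro y
  rcases eq_or_ne y 0 with rfl | hy
  · have hev : (fun y => φ (-Real.log y) * y ^ (-s)) =ᶠ[𝓝 0] fun _ => 0 := by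
      have h1 : ∀ᶠ t in atTop, φ t = 0 := by
        have := hc.isCompact.bddAbove
        obtain ⟨R, hR⟩ := this
        filter_upwards [eventually_gt_atTop R] with t ht
        by_contra hne
        exact absurd (hR (subset_tsupport _ hne)) (not_le.2 ht)
      have h2 : ∀ᶠ y in 𝓝[≠] (0 : ℝ), φ (-Real.log y) = 0 :=
        (tendsto_neg_atBot_atTop.comp Real.tendsto_log_nhdsNE_zero).eventually h1
      rw [eventually_nhdsWithin_iff] at h2
      filter_upwards [h2] with y hy
      by_cases hy0 : y = 0
      · simp [hy0, h0]
      · simp [hy hy0]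
    exact (continuousAt_const.congr hev.symm)
  · exact (hφ.continuousAt.comp (Real.continuousAt_log hy).neg).mul
      (Real.continuousAt_rpow_const _ _ (Or.inl hy))

lemma integral_polynomial_exp_neg_mul_eq_zero {h : ℝ → ℝ}
    (hint : ∀ k : ℕ, IntegrableOn (fun t => Real.exp (-k * t) * h t) (Ioi 0))
    (hz : ∀ k : ℕ, ∫ t in Ioi (0 : ℝ), Real.exp (-k * t) * h t = 0) (p : Polynomial ℝ) :
    IntegrableOn (fun t => p.eval (Real.exp (-t)) * h t) (Ioi 0) ∧
      ∫ t in Ioi (0 : ℝ), p.eval (Real.exp (-t)) * h t = 0 := by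
  induction p using Polynomial.induction_on' with
  | add p q hp hq =>
    simp only [Polynomial.eval_add, add_mul]
    refine ⟨hp.1.add hq.1, ?_⟩
    rw [integral_add hp.1 hq.1, hp.2, hq.2, add_zero]
  | monomial n a =>
    have hrw : (fun t => (Polynomial.monomial n a).eval (Real.exp (-t)) * h t)
        = fun t => a * (Real.exp (-n * t) * h t) := by
      funext t
      rw [Polynomial.eval_monomial, ← Real.exp_nat_mul]
      ring_nf
    rw [hrw]
    exact ⟨(hint n).const_mul a, by rw [integral_const_mul, hz n, mul_zero]⟩

/-- A function on `(0,∞)` is determined up to null sets by its Laplace transform near infinity. -/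
theorem ae_eq_zero_of_laplace_eq_zero {f : ℝ → ℝ} {s₀ : ℝ}
    (hf : ∀ s, s₀ < s → IntegrableOn (fun t => Real.exp (-s * t) * f t) (Ioi 0))
    (hz : ∀ s, s₀ < s → ∫ t in Ioi (0 : ℝ), Real.exp (-s * t) * f t = 0) :
    ∀ᵐ t ∂(volume.restrict (Ioi (0 : ℝ))), f t = 0 := by
  -- Damping by `exp(-st)` gives an integrable `h`. In the variable `y = exp(-t)` the transforms at
  -- `s + k` are its moments, so `h` annihilates all polynomials in `y`.
  set s := s₀ + 1 with hs
  set h : ℝ → ℝ := fun t => Real.exp (-s * t) * f t with hh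
  have hk : ∀ k : ℕ, (fun t => Real.exp (-k * t) * h t)
      = fun t => Real.exp (-(s + k) * t) * f t := by
    intro k
    funext t
    simp only [hh]
    rw [← mul_assoc, ← Real.exp_add]
    ring_nf
  have hgt : ∀ k : ℕ, s₀ < s + k := fun k => by
    have : (0 : ℝ) ≤ k := k.cast_nonneg
    linarith
  have hint : ∀ k : ℕ, IntegrableOn (fun t => Real.exp (-k * t) * h t) (Ioi 0) := fun k => by
    rw [hk]; exact hf _ (hgt k)
  have hzero : ∀ k : ℕ, ∫ t in Ioi (0 : ℝ), Real.exp (-k * t) * h t = 0 := fun k => by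
    rw [hk]; exact hz _ (hgt k)
  have hh0 : IntegrableOn h (Ioi 0) := hf s (by linarith)
  have hloc : LocallyIntegrableOn f (Ioi 0) := by
    have : f = fun t => Real.exp (s * t) * h t := by
      funext t
      simp only [hh]
      rw [← mul_assoc, ← Real.exp_add]
      simp
    rw [this]
    exact hh0.locallyIntegrableOn.continuousOn_mul (by fun_prop) isOpen_Ioi.isLocallyClosed
  have key := isOpen_Ioi.ae_eq_zero_of_integral_contDiff_smul_eq_zero hloc ?_
  · rwa [ae_restrict_iff' measurableSet_Ioi]
  intro φ hφ hcφ hsup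
  have h0 : φ 0 = 0 := by
    by_contra hne
    exact self_notMem_Ioi (hsup (subset_tsupport _ hne))
  have hφc : Continuous φ := hφ.continuous
  have hout : ∀ t ∉ Ioi (0 : ℝ), φ t • f t = 0 := fun t ht => by
    have : φ t = 0 := by
      by_contra hne
      exact ht (hsup (subset_tsupport _ hne))
    simp [this]
  rw [← setIntegral_eq_integral_of_forall_compl_eq_zero hout]
  -- The factor `y^(-s)` undoes the damping. Since `φ` has compact support, `g` is continuous even
  -- at `y = 0`, so Weierstrass approximation applies on `[0,1]`.
  set g : ℝ → ℝ := fun y => φ (-Real.log y) * y ^ (-s) with hg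
  have hgc : Continuous g := continuous_comp_neg_log_mul_rpow hφc hcφ h0 s
  have hgt' : ∀ t, g (Real.exp (-t)) * h t = φ t • f t := fun t => by
    simp only [hg, hh, Real.log_exp, neg_neg, smul_eq_mul]
    rw [← Real.exp_mul, mul_assoc, ← mul_assoc (Real.exp _), ← Real.exp_add]
    simp [mul_comm]
  simp_rw [← hgt']
  set C := ∫ t in Ioi (0 : ℝ), ‖h t‖ with hC
  have hC0 : 0 ≤ C := integral_nonneg fun _ => norm_nonneg _
  have hbound : ∀ ε > 0, ‖∫ t in Ioi (0 : ℝ), g (Real.exp (-t)) * h t‖ ≤ ε * C := by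
    intro ε hε
    obtain ⟨p, hp⟩ := exists_polynomial_near_of_continuousOn 0 1 g hgc.continuousOn ε hε
    obtain ⟨hpi, hpz⟩ := integral_polynomial_exp_neg_mul_eq_zero hint hzero p
    have hle : ∀ᵐ t ∂(volume.restrict (Ioi (0 : ℝ))),
        ‖g (Real.exp (-t)) * h t - p.eval (Real.exp (-t)) * h t‖ ≤ ε * ‖h t‖ := by
      filter_upwards [ae_restrict_mem measurableSet_Ioi] with t ht
      rw [← sub_mul, norm_mul]
      refine mul_le_mul_of_nonneg_right ?_ (norm_nonneg _)
      have := hp (Real.exp (-t)) ⟨(Real.exp_pos _).le, by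
        rw [Real.exp_le_one_iff]; exact neg_nonpos.2 (le_of_lt ht)⟩
      rw [Real.norm_eq_abs, abs_sub_comm]
      exact this.le
    have hmeas : AEStronglyMeasurable (fun t => g (Real.exp (-t)) * h t)
        (volume.restrict (Ioi (0 : ℝ))) :=
      (by fun_prop : Continuous fun t => g (Real.exp (-t))).aestronglyMeasurable.mul hh0.1
    have hdi : IntegrableOn (fun t => g (Real.exp (-t)) * h t
        - p.eval (Real.exp (-t)) * h t) (Ioi 0) :=
      Integrable.mono' (hh0.norm.const_mul ε) (hmeas.sub hpi.1) hle
    have hgi : IntegrableOn (fun t => g (Real.exp (-t)) * h t) (Ioi 0) := by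
      have := hdi.add hpi
      refine this.congr (Eventually.of_forall fun t => ?_)
      simp
    have heq : ∫ t in Ioi (0 : ℝ), g (Real.exp (-t)) * h t
        = ∫ t in Ioi (0 : ℝ), (g (Real.exp (-t)) * h t - p.eval (Real.exp (-t)) * h t) := by
      rw [integral_sub hgi hpi, hpz, sub_zero]
    rw [heq, hC, ← integral_const_mul]
    exact norm_integral_le_of_norm_le (hh0.norm.const_mul ε) hle
  have : ‖∫ t in Ioi (0 : ℝ), g (Real.exp (-t)) * h t‖ ≤ 0 := by
    refine le_of_forall_pos_le_add fun δ hδ => ?_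
    have := hbound (δ / (C + 1)) (by positivity)
    have h2 : δ / (C + 1) * C ≤ δ := by
      rw [div_mul_eq_mul_div, div_le_iff₀ (by positivity)]
      nlinarith
    linarith
  exact norm_le_zero_iff.1 this

theorem ae_eq_of_laplace_eq {f g : ℝ → ℝ} {s₀ : ℝ}
    (hf : ∀ s, s₀ < s → IntegrableOn (fun t => Real.exp (-s * t) * f t) (Ioi 0))
    (hg : ∀ s, s₀ < s → IntegrableOn (fun t => Real.exp (-s * t) * g t) (Ioi 0))
    (h : ∀ s, s₀ < s → ∫ t in Ioi (0 : ℝ), Real.exp (-s * t) * f t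
      = ∫ t in Ioi (0 : ℝ), Real.exp (-s * t) * g t) :
    f =ᵐ[volume.restrict (Ioi (0 : ℝ))] g := by
  have := ae_eq_zero_of_laplace_eq_zero (f := fun t => f t - g t) (s₀ := s₀)
    (fun s hs => by simp only [mul_sub]; exact (hf s hs).sub (hg s hs))
    (fun s hs => by
      simp only [mul_sub]
      rw [integral_sub (hf s hs) (hg s hs), h s hs, sub_self])
  filter_upwards [this] with t ht
  linarith

/-! ### From almost everywhere to everywhere -/

lemma exists_mem_Ioo_of_ae_restrict_Ioi {p : ℝ → Prop}
    (h : ∀ᵐ t ∂(volume.restrict (Ioi (0 : ℝ))), p t) {a b : ℝ} (ha : 0 ≤ a) (hab : a < b) :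
    ∃ t ∈ Ioo a b, p t := by
  by_contra! hne
  rw [ae_restrict_iff' measurableSet_Ioi, ae_iff] at h
  have hsub : Ioo a b ⊆ {t | ¬(t ∈ Ioi (0 : ℝ) → p t)} := fun t ht => by
    simp only [mem_ofPred_eq, Classical.not_imp]
    exact ⟨lt_of_le_of_lt ha ht.1, hne t ht⟩
  have := measure_mono_null hsub h
  rw [Real.volume_Ioo, ENNReal.ofReal_eq_zero] at this
  linarith

/-- If `f t ≠ g t`, continuity of `g` and monotonicity of `f` keep the two apart on a whole
one-sided interval at `t`, to the right when `f t` is larger and to the left when it is smaller.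
Such an interval has positive measure. -/
theorem MonotoneOn.eqOn_of_ae_eq_continuousOn {f g : ℝ → ℝ} (hf : MonotoneOn f (Ioi 0))
    (hg : ContinuousOn g (Ioi 0)) (h : f =ᵐ[volume.restrict (Ioi (0 : ℝ))] g) :
    EqOn f g (Ioi 0) := by
  intro t ht
  have ht' : (0 : ℝ) < t := ht
  have hct : ContinuousAt g t := hg.continuousAt (Ioi_mem_nhds ht')
  refine le_antisymm ?_ ?_
  · by_contra! hlt
    obtain ⟨δ, hδ, hball⟩ := Metric.eventually_nhds_iff.1 (hct.eventually_lt_const hlt)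
    obtain ⟨r, hr, hrr⟩ := exists_mem_Ioo_of_ae_restrict_Ioi h ht'.le (lt_add_of_pos_right t hδ)
    have h1 := hball (y := r) (by
      rw [Real.dist_eq, abs_of_pos (sub_pos.2 hr.1)]; linarith [hr.2])
    have h2 := hf ht (show (0 : ℝ) < r from ht'.trans hr.1) hr.1.le
    linarith
  · by_contra! hlt
    obtain ⟨δ, hδ, hball⟩ := Metric.eventually_nhds_iff.1 (hct.eventually_const_lt hlt)
    obtain ⟨r, hr, hrr⟩ := exists_mem_Ioo_of_ae_restrict_Ioi h (le_max_right (t - δ) 0)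
      (max_lt (sub_lt_self t hδ) ht')
    have hr1 := max_lt_iff.1 hr.1
    have h1 := hball (y := r) (by
      rw [Real.dist_eq, abs_of_neg (sub_neg.2 hr.2)]; linarith [hr1.1])
    have h2 := hf (show (0 : ℝ) < r from hr1.2) ht hr.2.le
    linarith

theorem AntitoneOn.eqOn_of_ae_eq_continuousOn {f g : ℝ → ℝ} (hf : AntitoneOn f (Ioi 0))
    (hg : ContinuousOn g (Ioi 0)) (h : f =ᵐ[volume.restrict (Ioi (0 : ℝ))] g) :
    EqOn f g (Ioi 0) := by
  have := hf.neg.eqOn_of_ae_eq_continuousOn hg.neg (h.mono fun t ht => by simp [ht])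
  intro t ht
  simpa using this ht

/-! ### Integrals in the logarithmic coordinate -/

section ExpSubstitution

variable {E : Type*} [NormedAddCommGroup E] [NormedSpace ℝ E]

lemma integrable_exp_smul_comp_exp_iff (g : ℝ → E) :
    Integrable (fun u => Real.exp u • g (Real.exp u)) ↔ IntegrableOn g (Ioi 0) := by
  have := integrableOn_image_iff_integrableOn_abs_deriv_smul (MeasurableSet.univ)
    (fun x _ => (Real.hasDerivAt_exp x).hasDerivWithinAt) Real.exp_injective.injOn g
  rw [image_univ, Real.range_exp] at this
  rw [this, integrableOn_univ]
  simp

lemma integral_exp_smul_comp_exp (g : ℝ → E) :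
    ∫ u, Real.exp u • g (Real.exp u) = ∫ r in Ioi (0 : ℝ), g r := by
  have := integral_image_eq_integral_abs_deriv_smul (MeasurableSet.univ)
    (fun x _ => (Real.hasDerivAt_exp x).hasDerivWithinAt) Real.exp_injective.injOn g
  rw [image_univ, Real.range_exp] at this
  rw [this, setIntegral_univ]
  simp

end ExpSubstitution

lemma integrable_exp_mul_mul_exp_neg_mul_exp {a b q : ℝ} (ha : 0 < a) (hb : 0 < b) (hq : 0 < q) :
    Integrable fun u : ℝ => Real.exp (a * u) * Real.exp (-b * Real.exp (q * u)) := by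
  have h := integrableOn_rpow_mul_exp_neg_mul_rpow (s := a - 1) (by linarith) hq hb
  rw [← integrable_exp_smul_comp_exp_iff] at h
  refine h.congr (Eventually.of_forall fun u => ?_)
  simp only [smul_eq_mul]
  rw [← Real.exp_mul, ← Real.exp_mul, ← mul_assoc, ← Real.exp_add]
  ring_nf

lemma integral_exp_mul_mul_exp_neg_mul_exp {a b : ℝ} (ha : 0 < a) (hb : 0 < b) :
    ∫ u : ℝ, Real.exp (a * u) * Real.exp (-b * Real.exp u) = b ^ (-a) * Real.Gamma a := by
  have h := Real.integral_rpow_mul_exp_neg_mul_Ioi ha hb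
  rw [← integral_exp_smul_comp_exp, one_div, Real.inv_rpow hb.le, ← Real.rpow_neg hb.le] at h
  rw [← h]
  congr 1
  funext u
  simp only [smul_eq_mul]
  rw [← Real.exp_mul, ← mul_assoc, ← Real.exp_add u, ← neg_mul]
  congr 2
  ring

/-- The integrand behaves like `exp(au)` at `-∞` and like `exp((a-1)u)` at `+∞`; this is where `0 <
a < 1` is needed. -/
lemma integrable_exp_mul_div_add {a s κ : ℝ} (ha0 : 0 < a) (ha1 : a < 1) (hs : 0 < s)
    (hκ : 0 < κ) : Integrable fun u : ℝ => Real.exp (a * u) / (s + κ * Real.exp u) := by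
  have hpos : ∀ u : ℝ, 0 < s + κ * Real.exp u := fun u => by positivity
  have hcont : Continuous fun u : ℝ => Real.exp (a * u) / (s + κ * Real.exp u) :=
    Continuous.div (by fun_prop) (by fun_prop) fun u => (hpos u).ne'
  rw [← integrableOn_univ, ← Iic_union_Ioi (a := (0 : ℝ)), integrableOn_union]
  constructor
  · refine Integrable.mono' ((integrableOn_exp_mul_Iic ha0 0).mul_const s⁻¹)
      hcont.aestronglyMeasurable (Eventually.of_forall fun u => ?_)
    rw [Real.norm_of_nonneg (div_pos (Real.exp_pos _) (hpos u)).le, div_eq_mul_inv]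
    gcongr
    have : 0 < κ * Real.exp u := by positivity
    linarith
  · refine Integrable.mono' ((integrableOn_exp_mul_Ioi (a := a - 1) (by linarith) 0).mul_const κ⁻¹)
      hcont.aestronglyMeasurable (Eventually.of_forall fun u => ?_)
    rw [Real.norm_of_nonneg (div_pos (Real.exp_pos _) (hpos u)).le, div_le_iff₀ (hpos u)]
    have h1 : Real.exp (a * u) = Real.exp ((a - 1) * u) * Real.exp u := by
      rw [← Real.exp_add]; ring_nf
    rw [h1]
    have h2 : Real.exp ((a - 1) * u) * κ⁻¹ * (s + κ * Real.exp u)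
        = Real.exp ((a - 1) * u) * Real.exp u + Real.exp ((a - 1) * u) * κ⁻¹ * s := by
      field_simp
      ring
    rw [h2]
    have : 0 < Real.exp ((a - 1) * u) * κ⁻¹ * s := by positivity
    linarith

/-! ### Contour shifts and the transform along a ray -/

/-- Cauchy's theorem on growing rectangles in a horizontal strip. -/
lemma tendsto_integral_sub_integral_of_strip {F : ℂ → ℂ} {y₁ y₂ : ℝ} (hy : y₁ ≤ y₂) {B : ℝ → ℝ}
    (hd : DifferentiableOn ℂ F {w | w.im ∈ Icc y₁ y₂})
    (htop : ∀ᶠ u : ℝ in atTop, ∀ y ∈ Icc y₁ y₂, ‖F (u + y * Complex.I)‖ ≤ B u)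
    (hbot : ∀ᶠ u : ℝ in atBot, ∀ y ∈ Icc y₁ y₂, ‖F (u + y * Complex.I)‖ ≤ B u)
    (hBtop : Tendsto B atTop (𝓝 0)) (hBbot : Tendsto B atBot (𝓝 0)) :
    Tendsto (fun R : ℝ => (∫ u in -R..R, F (u + y₁ * Complex.I))
      - ∫ u in -R..R, F (u + y₂ * Complex.I)) atTop (𝓝 0) := by
  have hlim : Tendsto (fun R => (B R + B (-R)) * |y₂ - y₁|) atTop (𝓝 0) := by
    have := (hBtop.add (hBbot.comp tendsto_neg_atTop_atBot)).mul_const |y₂ - y₁|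
    simpa using this
  refine squeeze_zero_norm' ?_ hlim
  filter_upwards [htop, tendsto_neg_atTop_atBot.eventually hbot] with R h1 h2
  have hrect := Complex.integral_boundary_rect_eq_zero_of_differentiableOn F
    ((-R : ℝ) + y₁ * Complex.I) ((R : ℝ) + y₂ * Complex.I) (hd.mono fun w hw => by
      have := hw.2
      simp only [mem_preimage, Complex.add_im, Complex.ofReal_im, Complex.mul_im,
        Complex.ofReal_re, Complex.I_im, Complex.I_re, mul_one, mul_zero, zero_add, add_zero,
        uIcc_of_le hy] at this
      exact this)
  simp only [Complex.add_im, Complex.ofReal_im, Complex.mul_im, Complex.add_re, Complex.mul_re,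
    Complex.ofReal_re, Complex.I_im, Complex.I_re, mul_one, mul_zero, zero_add, add_zero,
    sub_zero] at hrect
  have hV : ∀ u : ℝ, (∀ y ∈ Icc y₁ y₂, ‖F (u + y * Complex.I)‖ ≤ B u) →
      ‖∫ y : ℝ in y₁..y₂, F (u + y * Complex.I)‖ ≤ B u * |y₂ - y₁| := fun u hu =>
    intervalIntegral.norm_integral_le_of_norm_le_const fun y hy' => by
      rw [uIoc_of_le hy] at hy'
      exact hu y ⟨hy'.1.le, hy'.2⟩
  have e1 := hV R h1
  have e2 := hV (-R) h2
  have heq : (∫ u in -R..R, F (u + y₁ * Complex.I)) - ∫ u in -R..R, F (u + y₂ * Complex.I)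
      = Complex.I • (∫ y : ℝ in y₁..y₂, F ((-R : ℝ) + y * Complex.I))
        - Complex.I • ∫ y : ℝ in y₁..y₂, F (R + y * Complex.I) := by
    linear_combination hrect
  rw [heq]
  refine (norm_sub_le _ _).trans ?_
  rw [norm_smul, norm_smul, Complex.norm_I, one_mul, one_mul]
  linarith

lemma norm_cexp_add_mul_I (u y : ℝ) : ‖Complex.exp (u + y * Complex.I)‖ = Real.exp u := by
  simp [Complex.norm_exp]

lemma cexp_add_mul_I_re (u y : ℝ) :
    (Complex.exp (u + y * Complex.I)).re = Real.exp u * Real.cos y := by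
  simp [Complex.exp_re]

lemma norm_cexp_mul_cexp (t u y : ℝ) :
    ‖Complex.exp (t * Complex.exp (u + y * Complex.I))‖
      = Real.exp (t * (Real.exp u * Real.cos y)) := by
  rw [Complex.norm_exp, Complex.re_ofReal_mul, cexp_add_mul_I_re]

/-- When `cos y < 0` the left side is positive and grows like `exp u`, which controls the Cauchy
kernel `1/(s - z)` along the ray. -/
lemma le_norm_sub_cexp (s u y : ℝ) :
    s + -Real.cos y * Real.exp u ≤ ‖(s : ℂ) - Complex.exp (u + y * Complex.I)‖ := by
  refine le_trans (le_of_eq ?_) (Complex.re_le_norm _)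
  rw [Complex.sub_re, cexp_add_mul_I_re, Complex.ofReal_re]
  ring

/-- Inverse Laplace transform of `Φ (log s) / s`, as an integral along the ray `arg z = θ`
parametrized by `z = exp (u + iθ)`. -/
noncomputable def rayTransform (θ : ℝ) (Φ : ℂ → ℂ) (t : ℝ) : ℝ :=
  1 / Real.pi * (∫ u : ℝ, Complex.exp (t * Complex.exp (u + θ * Complex.I))
    * Φ (u + θ * Complex.I)).im

lemma neg_cos_pos {θ : ℝ} (h₁ : Real.pi / 2 < θ) (h₂ : θ < Real.pi) : 0 < -Real.cos θ :=
  neg_pos.2 (Real.cos_neg_of_pi_div_two_lt_of_lt h₁ (by linarith [Real.pi_pos]))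

lemma integral_exp_neg_mul_cexp_mul (z : ℂ) {s : ℝ} (hz : z.re < s) :
    IntegrableOn (fun t : ℝ => (Real.exp (-s * t) : ℂ) * Complex.exp (t * z)) (Ioi 0) ∧
    ∫ t in Ioi (0 : ℝ), (Real.exp (-s * t) : ℂ) * Complex.exp (t * z) = 1 / (s - z) := by
  have hre : (z - s).re < 0 := by simpa using hz
  have hfun : (fun t : ℝ => (Real.exp (-s * t) : ℂ) * Complex.exp (t * z))
      = fun t : ℝ => Complex.exp ((z - s) * t) := by
    funext t
    rw [Complex.ofReal_exp, ← Complex.exp_add]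
    push_cast
    ring_nf
  rw [hfun]
  refine ⟨integrableOn_exp_mul_complex_Ioi hre 0, ?_⟩
  rw [integral_exp_mul_complex_Ioi hre 0]
  rw [← neg_sub (s : ℂ) z, div_neg]
  simp [neg_div]

/-- Laplace transform of `rayTransform` by Fubini's theorem. -/
lemma laplace_rayTransform_fubini {θ : ℝ} (h₁ : Real.pi / 2 < θ) (h₂ : θ < Real.pi) {Φ : ℂ → ℂ}
    (hΦ : Continuous Φ) {s : ℝ} (hs : 0 < s)
    (hint : Integrable fun u : ℝ => ‖Φ (u + θ * Complex.I)‖ / (s + -Real.cos θ * Real.exp u)) :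
    IntegrableOn (fun t => Real.exp (-s * t) * rayTransform θ Φ t) (Ioi 0) ∧
    (∫ t in Ioi (0 : ℝ), ‖Real.exp (-s * t) * rayTransform θ Φ t‖
      ≤ 1 / Real.pi * ∫ u : ℝ, ‖Φ (u + θ * Complex.I)‖ / (s + -Real.cos θ * Real.exp u)) ∧
    ∫ t in Ioi (0 : ℝ), Real.exp (-s * t) * rayTransform θ Φ t
      = 1 / Real.pi * (∫ u : ℝ, Φ (u + θ * Complex.I)
          / (s - Complex.exp (u + θ * Complex.I))).im := by
  have hκ := neg_cos_pos h₁ h₂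
  set f : ℝ × ℝ → ℂ := fun p => (Real.exp (-s * p.1) : ℂ)
    * (Complex.exp (p.1 * Complex.exp (p.2 + θ * Complex.I)) * Φ (p.2 + θ * Complex.I)) with hf
  have hfc : Continuous f := by fun_prop
  have hre : ∀ u : ℝ, (Complex.exp (u + θ * Complex.I)).re < s := fun u => by
    rw [cexp_add_mul_I_re]
    nlinarith [Real.exp_pos u]
  have hnorm : ∀ p : ℝ × ℝ, ‖f p‖ = ‖Φ (p.2 + θ * Complex.I)‖
      * Real.exp (-(s + -Real.cos θ * Real.exp p.2) * p.1) := fun p => by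
    simp only [hf]
    rw [norm_mul, norm_mul, norm_cexp_mul_cexp, Complex.norm_real, Real.norm_of_nonneg
      (Real.exp_pos _).le, ← mul_assoc, ← Real.exp_add, mul_comm]
    ring_nf
  have hpos : ∀ u : ℝ, 0 < s + -Real.cos θ * Real.exp u := fun u => by positivity
  have hinorm : ∀ u : ℝ, ∫ t in Ioi (0 : ℝ), ‖f (t, u)‖
      = ‖Φ (u + θ * Complex.I)‖ / (s + -Real.cos θ * Real.exp u) := fun u => by
    simp only [hnorm]
    rw [integral_const_mul, integral_exp_mul_Ioi (neg_neg_of_pos (hpos u))]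
    rw [mul_zero, Real.exp_zero, neg_div_neg_eq, mul_one_div]
  have hfi : Integrable f ((volume.restrict (Ioi (0 : ℝ))).prod volume) := by
    rw [integrable_prod_iff' hfc.aestronglyMeasurable]
    refine ⟨Eventually.of_forall fun u => ?_, ?_⟩
    · have := (integral_exp_neg_mul_cexp_mul _ (hre u)).1.mul_const (Φ (u + θ * Complex.I))
      simpa only [hf, mul_assoc] using this
    · simpa only [hinorm] using hint
  have hray : ∀ t : ℝ, Real.exp (-s * t) * rayTransform θ Φ t
      = 1 / Real.pi * (∫ u, f (t, u)).im := fun t => by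
    simp only [hf]
    rw [integral_const_mul, Complex.im_ofReal_mul, rayTransform]
    ring
  have hI1 : Integrable (fun t => ∫ u, f (t, u)) (volume.restrict (Ioi (0 : ℝ))) :=
    hfi.integral_prod_left
  simp only [hray]
  refine ⟨hI1.im.const_mul _, ?_, ?_⟩
  · have hle : ∀ t : ℝ, ‖1 / Real.pi * (∫ u, f (t, u)).im‖ ≤ 1 / Real.pi * ∫ u, ‖f (t, u)‖ := by
      intro t
      rw [norm_mul, Real.norm_of_nonneg (by positivity : 0 ≤ 1 / Real.pi)]
      gcongr
      exact (Complex.abs_im_le_norm _).trans (norm_integral_le_integral_norm _)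
    have hI2 := hfi.norm.integral_prod_left
    calc ∫ t in Ioi (0 : ℝ), ‖1 / Real.pi * (∫ u, f (t, u)).im‖
        ≤ ∫ t in Ioi (0 : ℝ), 1 / Real.pi * ∫ u, ‖f (t, u)‖ :=
          integral_mono (hI1.im.const_mul _).norm (hI2.const_mul _) hle
      _ = 1 / Real.pi * ∫ t in Ioi (0 : ℝ), ∫ u, ‖f (t, u)‖ := integral_const_mul _ _
      _ = _ := by
          rw [integral_integral_swap hfi.norm]
          simp only [hinorm]
  · rw [integral_const_mul]
    congr 1
    rw [show (∫ t in Ioi (0 : ℝ), (∫ u, f (t, u)).im) = (∫ t in Ioi (0 : ℝ), ∫ u, f (t, u)).im from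
      integral_im hI1]
    rw [integral_integral_swap hfi]
    congr 2
    funext u
    have := (integral_exp_neg_mul_cexp_mul _ (hre u)).2
    simp only [hf, ← mul_assoc]
    rw [integral_mul_const, this]
    ring

lemma tendsto_exp_mul_mul_exp_neg_mul_exp_atTop (a : ℝ) {b : ℝ} (hb : 0 < b) :
    Tendsto (fun u : ℝ => Real.exp (a * u) * Real.exp (-b * Real.exp u)) atTop (𝓝 0) := by
  have := (tendsto_rpow_mul_exp_neg_mul_atTop_nhds_zero a b hb).comp Real.tendsto_exp_atTop
  refine this.congr fun u => ?_
  simp only [Function.comp]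
  rw [← Real.exp_mul, mul_comm u a]

lemma tendsto_exp_mul_atBot {a : ℝ} (ha : 0 < a) :
    Tendsto (fun u : ℝ => Real.exp (a * u)) atBot (𝓝 0) :=
  Real.tendsto_exp_atBot.comp (tendsto_id.const_mul_atBot ha)

/-- In the sector `θ ≤ arg z ≤ π` the factor `exp(tz)` decays, so the ray can be rotated to the
negative axis. There the integral is `Γ(a) t^(-a) exp(iπa)`, and the reflection formula turns `Γ(a)
sin(πa)/π` into `1/Γ(1-a)`. -/
lemma rayTransform_cexp {θ : ℝ} (h₁ : Real.pi / 2 < θ) (h₂ : θ < Real.pi) {a : ℝ} (ha0 : 0 < a)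
    {t : ℝ} (ht : 0 < t) :
    rayTransform θ (fun w => Complex.exp (a * w)) t = t ^ (-a) / Real.Gamma (1 - a) := by
  have hκ := neg_cos_pos h₁ h₂
  set F : ℂ → ℂ := fun w => Complex.exp (t * Complex.exp w) * Complex.exp (a * w) with hF
  have hFc : Continuous F := by fun_prop
  set B : ℝ → ℝ := fun u => Real.exp (a * u) * Real.exp (-(t * -Real.cos θ) * Real.exp u) with hB
  have hBi : Integrable B := by
    have := integrable_exp_mul_mul_exp_neg_mul_exp ha0 (mul_pos ht hκ) one_pos
    simpa only [one_mul] using this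
  have hbound : ∀ u : ℝ, ∀ y ∈ Icc θ Real.pi, ‖F (u + y * Complex.I)‖ ≤ B u := by
    intro u y hy
    have hcos : Real.cos y ≤ Real.cos θ :=
      Real.cos_le_cos_of_nonneg_of_le_pi (by linarith [Real.pi_pos]) hy.2 hy.1
    simp only [hF, hB]
    rw [norm_mul, norm_cexp_mul_cexp, mul_comm]
    have h3 : ‖Complex.exp (a * (u + y * Complex.I))‖ = Real.exp (a * u) := by
      simp [Complex.norm_exp]
    rw [h3]
    refine mul_le_mul_of_nonneg_left (Real.exp_le_exp.2 ?_) (Real.exp_pos _).le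
    have : t * Real.exp u * Real.cos y ≤ t * Real.exp u * Real.cos θ := by gcongr
    linarith
  have hBbot : Tendsto B atBot (𝓝 0) := by
    refine squeeze_zero (fun u => by positivity) (fun u => ?_) (tendsto_exp_mul_atBot ha0)
    refine mul_le_of_le_one_right (Real.exp_pos _).le ?_
    rw [Real.exp_le_one_iff]
    have : 0 < t * -Real.cos θ * Real.exp u := by positivity
    linarith
  have hline : ∀ y ∈ Icc θ Real.pi, Integrable fun u : ℝ => F (u + y * Complex.I) := fun y hy =>
    hBi.mono' (by fun_prop) (Eventually.of_forall fun u => hbound u y hy)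
  have hlim : ∀ y ∈ Icc θ Real.pi, Tendsto (fun R : ℝ => ∫ u in -R..R, F (u + y * Complex.I))
      atTop (𝓝 (∫ u : ℝ, F (u + y * Complex.I))) := fun y hy =>
    intervalIntegral_tendsto_integral (hline y hy) tendsto_neg_atTop_atBot tendsto_id
  have hθ : θ ∈ Icc θ Real.pi := ⟨le_rfl, h₂.le⟩
  have hπ : Real.pi ∈ Icc θ Real.pi := ⟨h₂.le, le_rfl⟩
  have hzero := tendsto_integral_sub_integral_of_strip h₂.le (F := F) (B := B)
    (by fun_prop) (Eventually.of_forall hbound) (Eventually.of_forall hbound)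
    (tendsto_exp_mul_mul_exp_neg_mul_exp_atTop a (mul_pos ht hκ)) hBbot
  have heq : ∫ u : ℝ, F (u + θ * Complex.I) = ∫ u : ℝ, F (u + Real.pi * Complex.I) :=
    sub_eq_zero.1 (tendsto_nhds_unique ((hlim θ hθ).sub (hlim _ hπ)) hzero)
  have hpi : ∀ u : ℝ, F (u + Real.pi * Complex.I)
      = ((Real.exp (a * u) * Real.exp (-t * Real.exp u) : ℝ) : ℂ)
        * Complex.exp ((a * Real.pi : ℝ) * Complex.I) := fun u => by
    simp only [hF]
    rw [Complex.exp_add, Complex.exp_pi_mul_I, mul_add, Complex.exp_add]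
    push_cast
    ring_nf
  have hfin : (∫ u : ℝ, F (u + θ * Complex.I)).im
      = t ^ (-a) * Real.Gamma a * Real.sin (a * Real.pi) := by
    rw [heq]
    simp only [hpi]
    rw [integral_mul_const, integral_complex_ofReal, integral_exp_mul_mul_exp_neg_mul_exp ha0 ht,
      Complex.im_ofReal_mul, Complex.exp_ofReal_mul_I_im]
  have href := Real.Gamma_mul_Gamma_one_sub a
  change 1 / Real.pi * (∫ u : ℝ, F (u + θ * Complex.I)).im = _
  rw [hfin]
  rw [mul_comm a Real.pi]
  -- If `sin(πa) = 0`, the convention `π/0 = 0` in the reflection formula gives the default value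
  -- `Γ(1-a) = 0` at the pole, and both sides are `0`.
  by_cases hsin : Real.sin (Real.pi * a) = 0
  · have hG : Real.Gamma (1 - a) = 0 := by
      rw [hsin, div_zero] at href
      exact (mul_eq_zero.1 href).resolve_left (Real.Gamma_pos_of_pos ha0).ne'
    simp [hsin, hG]
  · have hG : Real.Gamma (1 - a) ≠ 0 := by
      intro h0
      rw [h0, mul_zero] at href
      exact (div_ne_zero Real.pi_ne_zero hsin) href.symm
    rw [eq_div_iff hsin] at href
    field_simp
    linear_combination href

/-! ### Laplace inversion along the ray -/

/-- The class of functions `Φ` for which `rayTransform θ Φ` inverts the Laplace transform: entire,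
real on the real axis and dominated by `exp (a Re w) + exp (b Re w)` on the strip
`0 ≤ Im w ≤ θ`, where `0 < a, b < 1`. -/
structure IsRayAdmissible (θ a b C : ℝ) (Φ : ℂ → ℂ) : Prop where
  differentiable : Differentiable ℂ Φ
  im_eq_zero : ∀ u : ℝ, (Φ u).im = 0
  bound : ∀ u y : ℝ, y ∈ Icc 0 θ →
    ‖Φ (u + y * Complex.I)‖ ≤ C * (Real.exp (a * u) + Real.exp (b * u))

/-- `exp` is injective on the strip `0 ≤ Im w < π` and its derivative has no zeros. -/
lemma dslope_cexp_ne_zero (x : ℝ) {w : ℂ} (h₀ : 0 ≤ w.im) (h₁ : w.im < Real.pi) :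
    dslope Complex.exp x w ≠ 0 := by
  rcases eq_or_ne w x with rfl | hne
  · rw [dslope_same, Complex.deriv_exp]
    exact Complex.exp_ne_zero _
  · rw [dslope_of_ne _ hne, slope_def_field]
    refine div_ne_zero (sub_ne_zero.2 fun h => hne ?_) (sub_ne_zero.2 hne)
    exact Complex.exp_inj_of_neg_pi_lt_of_le_pi (by linarith [Real.pi_pos]) h₁.le
      (by simpa using Real.pi_pos) (by simpa using Real.pi_pos.le) h

/-- A quotient of divided differences extends `Φ w / (s - exp w)`, with `s = exp x`, across the
removable singularity at `w = x`. -/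
lemma div_sub_cexp_eq_dslope {Φ : ℂ → ℂ} {x : ℝ} (hx : Φ x = 0) {w : ℂ} (hne : w ≠ x) :
    -dslope Φ x w / dslope Complex.exp x w = Φ w / (Real.exp x - Complex.exp w) := by
  rw [dslope_of_ne _ hne, dslope_of_ne _ hne, slope_def_field, slope_def_field, hx, sub_zero,
    Complex.ofReal_exp]
  have := sub_ne_zero.2 hne
  rw [← neg_sub (Complex.exp w), div_neg, neg_div, div_div_div_cancel_right₀ this]

lemma tendsto_exp_mul_div_abs_sub_exp {a s : ℝ} (ha0 : 0 < a) (ha1 : a < 1) (hs : 0 < s) :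
    Tendsto (fun u : ℝ => Real.exp (a * u) / |s - Real.exp u|) atTop (𝓝 0) ∧
    Tendsto (fun u : ℝ => Real.exp (a * u) / |s - Real.exp u|) atBot (𝓝 0) := by
  constructor
  · have h1 : Tendsto (fun u : ℝ => Real.exp ((a - 1) * u) / |s * Real.exp (-u) - 1|) atTop
        (𝓝 (0 / |s * 0 - 1|)) := by
      refine Tendsto.div ?_ ?_ (by simp)
      · exact Real.tendsto_exp_atBot.comp (tendsto_id.const_mul_atTop_of_neg (by linarith))
      · exact (((Real.tendsto_exp_neg_atTop_nhds_zero).const_mul s).sub_const 1).abs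
    rw [zero_div] at h1
    refine h1.congr fun u => ?_
    have h2 : |s - Real.exp u| = |s * Real.exp (-u) - 1| * Real.exp u := by
      rw [← abs_of_pos (Real.exp_pos u), ← abs_mul, sub_mul, mul_assoc,
        abs_of_pos (Real.exp_pos u), ← Real.exp_add]
      simp
    rw [h2, sub_mul, Real.exp_sub, one_mul, div_div,
      mul_comm (Real.exp u)]
  · have h1 : Tendsto (fun u : ℝ => Real.exp (a * u) / |s - Real.exp u|) atBot
        (𝓝 (0 / |s - 0|)) := by
      refine Tendsto.div (tendsto_exp_mul_atBot ha0) ?_ (by simpa using hs.ne')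
      exact (Real.tendsto_exp_atBot.const_sub s).abs
    simpa using h1

namespace IsRayAdmissible

variable {θ a b C : ℝ} {Φ : ℂ → ℂ}

lemma integrable_norm_div (hΦ : IsRayAdmissible θ a b C Φ) (h₁ : Real.pi / 2 < θ)
    (h₂ : θ < Real.pi) (ha : a ∈ Ioo 0 1) (hb : b ∈ Ioo 0 1) {s : ℝ} (hs : 0 < s) :
    Integrable fun u : ℝ => ‖Φ (u + θ * Complex.I)‖ / (s + -Real.cos θ * Real.exp u) := by
  have hκ := neg_cos_pos h₁ h₂
  have hpos : ∀ u : ℝ, 0 < s + -Real.cos θ * Real.exp u := fun u => by positivity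
  have hc := hΦ.differentiable.continuous
  refine (((integrable_exp_mul_div_add ha.1 ha.2 hs hκ).add
    (integrable_exp_mul_div_add hb.1 hb.2 hs hκ)).const_mul C).mono'
    (Continuous.aestronglyMeasurable (Continuous.div (by fun_prop) (by fun_prop)
      fun u => (hpos u).ne')) (Eventually.of_forall fun u => ?_)
  rw [Real.norm_of_nonneg (div_nonneg (norm_nonneg _) (hpos u).le), Pi.add_apply, ← add_div,
    ← mul_div_assoc]
  have := hΦ.bound u θ ⟨by linarith [Real.pi_pos], le_rfl⟩
  have := (hpos u).le
  gcongr

lemma integrable_div (hΦ : IsRayAdmissible θ a b C Φ) (h₁ : Real.pi / 2 < θ)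
    (h₂ : θ < Real.pi) (ha : a ∈ Ioo 0 1) (hb : b ∈ Ioo 0 1) {s : ℝ} (hs : 0 < s) :
    Integrable fun u : ℝ => Φ (u + θ * Complex.I) / (s - Complex.exp (u + θ * Complex.I)) := by
  have hκ := neg_cos_pos h₁ h₂
  have hpos : ∀ u : ℝ, 0 < s + -Real.cos θ * Real.exp u := fun u => by positivity
  have hc := hΦ.differentiable.continuous
  refine (hΦ.integrable_norm_div h₁ h₂ ha hb hs).mono'
    (Continuous.aestronglyMeasurable (Continuous.div (by fun_prop) (by fun_prop)
      fun u => ?_)) (Eventually.of_forall fun u => ?_)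
  · exact norm_pos_iff.1 ((hpos u).trans_le (le_norm_sub_cexp s u θ))
  · rw [norm_div]
    have := hpos u
    gcongr
    exact le_norm_sub_cexp s u θ

/-- If `Φ` vanishes at `log s`, the Stieltjes-type integral along the ray is real. -/
lemma im_integral_div_eq_zero (hΦ : IsRayAdmissible θ a b C Φ) (h₁ : Real.pi / 2 < θ)
    (h₂ : θ < Real.pi) (ha : a ∈ Ioo 0 1) (hb : b ∈ Ioo 0 1) {s : ℝ} (hs : 0 < s)
    (hz : Φ (Real.log s) = 0) :
    (∫ u : ℝ, Φ (u + θ * Complex.I) / (s - Complex.exp (u + θ * Complex.I))).im = 0 := by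
  set x := Real.log s with hx
  have hsx : Real.exp x = s := Real.exp_log hs
  have hθ0 : 0 < θ := by linarith [Real.pi_pos]
  set G : ℂ → ℂ := fun w => -dslope Φ x w / dslope Complex.exp x w with hG
  have hGeq : ∀ w : ℂ, w ≠ x → G w = Φ w / (s - Complex.exp w) := fun w hw => by
    rw [hG, ← hsx]
    exact div_sub_cexp_eq_dslope hz hw
  have hds : ∀ f : ℂ → ℂ, Differentiable ℂ f → Differentiable ℂ (dslope f x) := fun f hf => by
    rw [← differentiableOn_univ, Complex.differentiableOn_dslope univ_mem]
    exact hf.differentiableOn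
  have hGd : DifferentiableOn ℂ G {w | w.im ∈ Icc 0 θ} :=
    DifferentiableOn.div (hds Φ hΦ.differentiable).neg.differentiableOn
      (hds _ Complex.differentiable_exp).differentiableOn
      fun w hw => dslope_cexp_ne_zero x hw.1 (hw.2.trans_lt h₂)
  set B : ℝ → ℝ := fun u => C * (Real.exp (a * u) / |s - Real.exp u|
    + Real.exp (b * u) / |s - Real.exp u|) with hB
  have hbound : ∀ u : ℝ, u ≠ x → ∀ y ∈ Icc 0 θ, ‖G (u + y * Complex.I)‖ ≤ B u := by
    intro u hu y hy
    rw [hGeq _ fun h => hu (by simpa using congrArg Complex.re h), norm_div]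
    simp only [hB]
    rw [← add_div, ← mul_div_assoc]
    have hne : 0 < |s - Real.exp u| := abs_pos.2 (sub_ne_zero.2 fun h => hu (by
      rw [hx, h, Real.log_exp]))
    have hle : |s - Real.exp u| ≤ ‖(s : ℂ) - Complex.exp (u + y * Complex.I)‖ := by
      have := abs_norm_sub_norm_le (s : ℂ) (Complex.exp (u + y * Complex.I))
      rwa [norm_cexp_add_mul_I, Complex.norm_real, Real.norm_of_nonneg hs.le] at this
    have := hΦ.bound u y hy
    have h0 : 0 ≤ C * (Real.exp (a * u) + Real.exp (b * u)) := (norm_nonneg _).trans this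
    gcongr
  obtain ⟨ha1, ha2⟩ := tendsto_exp_mul_div_abs_sub_exp ha.1 ha.2 hs
  obtain ⟨hb1, hb2⟩ := tendsto_exp_mul_div_abs_sub_exp hb.1 hb.2 hs
  have hlim := tendsto_integral_sub_integral_of_strip hθ0.le hGd
    ((eventually_ne_atTop x).mono hbound) ((eventually_ne_atBot x).mono hbound)
    (by simpa using (ha1.add hb1).const_mul C) (by simpa using (ha2.add hb2).const_mul C)
  have htopeq : ∀ u : ℝ, G (u + θ * Complex.I)
      = Φ (u + θ * Complex.I) / (s - Complex.exp (u + θ * Complex.I)) := fun u =>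
    hGeq _ fun h => hθ0.ne' (by simpa using congrArg Complex.im h)
  -- The lower side of the rectangle is the real axis, where the integrand is real off the single
  -- point `x`. The integral along the ray is the limit of these real integrals.
  have hbot : ∀ R : ℝ, (∫ u in -R..R, G (u + (0 : ℝ) * Complex.I)).im = 0 := by
    intro R
    have hreal : ∀ᵐ u : ℝ, u ∈ uIoc (-R) R → G (u + (0 : ℝ) * Complex.I)
        = (((Φ u).re / (s - Real.exp u) : ℝ) : ℂ) := by
      have : ∀ᵐ u : ℝ, u ≠ x := by simp [ae_iff]
      filter_upwards [this] with u hu _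
      rw [Complex.ofReal_zero, zero_mul, add_zero, hGeq _ (by exact_mod_cast hu)]
      push_cast
      congr 1
      exact Complex.ext (by simp) (by simp [hΦ.im_eq_zero u])
    rw [intervalIntegral.integral_congr_ae hreal, intervalIntegral.integral_ofReal,
      Complex.ofReal_im]
  have hint := hΦ.integrable_div h₁ h₂ ha hb hs
  simp only [htopeq] at hlim
  have h3 := intervalIntegral_tendsto_integral hint tendsto_neg_atTop_atBot tendsto_id
  have h4 := (Complex.continuous_im.tendsto _).comp (hlim.add h3)
  have h5 : Tendsto (fun _ : ℝ => (0 : ℝ)) atTop (𝓝 ((0 + ∫ u : ℝ, Φ (u + θ * Complex.I)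
      / (s - Complex.exp (u + θ * Complex.I))).im)) := by
    refine h4.congr fun R => ?_
    simp only [Function.comp, id]
    rw [sub_add_cancel]
    exact hbot R
  rw [zero_add] at h5
  exact (tendsto_nhds_unique h5 tendsto_const_nhds)

lemma cexp_mul : IsRayAdmissible θ a b 1 fun w => Complex.exp (a * w) where
  differentiable := by fun_prop
  im_eq_zero u := by
    rw [← Complex.ofReal_mul, ← Complex.ofReal_exp, Complex.ofReal_im]
  bound u y _ := by
    have h3 : ‖Complex.exp (a * (u + y * Complex.I))‖ = Real.exp (a * u) := by
      simp [Complex.norm_exp]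
    rw [h3]
    nlinarith [Real.exp_pos (a * u), Real.exp_pos (b * u)]

/-- The Laplace transform of `rayTransform θ Φ` at `s` is `Φ (log s) / s`. -/
theorem laplace_rayTransform (hΦ : IsRayAdmissible θ a b C Φ) (h₁ : Real.pi / 2 < θ)
    (h₂ : θ < Real.pi) (ha : a ∈ Ioo 0 1) (hb : b ∈ Ioo 0 1) {s : ℝ} (hs : 0 < s) :
    ∫ t in Ioi (0 : ℝ), Real.exp (-s * t) * rayTransform θ Φ t = (Φ (Real.log s)).re / s := by
  rw [(laplace_rayTransform_fubini h₁ h₂ hΦ.differentiable.continuous hs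
    (hΦ.integrable_norm_div h₁ h₂ ha hb hs)).2.2]
  have hE : IsRayAdmissible θ a b 1 fun w => Complex.exp (a * w) := cexp_mul
  -- For the pure power the transform is a Gamma integral, so the value of its Stieltjes integral is
  -- known without a residue.
  have hEs : 1 / Real.pi * (∫ u : ℝ, Complex.exp (a * (u + θ * Complex.I))
      / (s - Complex.exp (u + θ * Complex.I))).im = s ^ a / s := by
    rw [← (laplace_rayTransform_fubini h₁ h₂ hE.differentiable.continuous hs
      (hE.integrable_norm_div h₁ h₂ ha hb hs)).2.2]
    have h1a : 0 < 1 - a := by linarith [ha.2]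
    have := Real.integral_rpow_mul_exp_neg_mul_Ioi h1a hs
    calc ∫ t in Ioi (0 : ℝ), Real.exp (-s * t) * rayTransform θ (fun w => Complex.exp (a * w)) t
        = ∫ t in Ioi (0 : ℝ), t ^ (1 - a - 1) * Real.exp (-(s * t)) * (Real.Gamma (1 - a))⁻¹ := by
          refine setIntegral_congr_fun measurableSet_Ioi fun t ht => ?_
          rw [rayTransform_cexp h₁ h₂ ha.1 ht]
          ring_nf
      _ = s ^ a / s := by
          rw [integral_mul_const, this, mul_assoc, mul_inv_cancel₀ (Real.Gamma_pos_of_pos h1a).ne',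
            mul_one, one_div, Real.inv_rpow hs.le, Real.rpow_sub hs, Real.rpow_one, inv_div]
  -- With this `c` the function `Φ - c exp(aw)` vanishes at `log s`, so the Stieltjes integral of
  -- `Φ` has the same imaginary part as `c` times that of the power.
  set c : ℝ := (Φ (Real.log s)).re / s ^ a with hc
  have hsa : 0 < s ^ a := Real.rpow_pos_of_pos hs a
  set Φ₁ : ℂ → ℂ := fun w => Φ w - c * Complex.exp (a * w) with hΦ₁
  have hadm : IsRayAdmissible θ a b (C + |c|) Φ₁ := by
    refine ⟨hΦ.differentiable.sub (by fun_prop), fun u => ?_, fun u y hy => ?_⟩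
    · rw [hΦ₁, Complex.sub_im, hΦ.im_eq_zero, Complex.im_ofReal_mul, hE.im_eq_zero]
      simp
    · refine (norm_sub_le _ _).trans ?_
      rw [norm_mul, Complex.norm_real, Real.norm_eq_abs, add_mul]
      refine add_le_add (hΦ.bound u y hy) ?_
      gcongr
      simpa using hE.bound u y hy
  have hz : Φ₁ (Real.log s) = 0 := by
    have h1 : Complex.exp (a * Real.log s) = ((s ^ a : ℝ) : ℂ) := by
      rw [Real.rpow_def_of_pos hs]
      push_cast
      ring_nf
    have h2 : Φ (Real.log s) = ((Φ (Real.log s)).re : ℂ) :=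
      Complex.ext (by simp) (by simp [hΦ.im_eq_zero])
    simp only [hΦ₁]
    rw [h1, h2, hc, ← Complex.ofReal_mul, div_mul_cancel₀ _ hsa.ne', sub_self]
  have key := hadm.im_integral_div_eq_zero h₁ h₂ ha hb hs hz
  have i1 := hΦ.integrable_div h₁ h₂ ha hb hs
  have i2 := (hE.integrable_div h₁ h₂ ha hb hs).const_mul (c : ℂ)
  have hsplit : ∀ u : ℝ, Φ₁ (u + θ * Complex.I) / (s - Complex.exp (u + θ * Complex.I))
      = Φ (u + θ * Complex.I) / (s - Complex.exp (u + θ * Complex.I))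
        - c * (Complex.exp (a * (u + θ * Complex.I)) / (s - Complex.exp (u + θ * Complex.I))) :=
    fun u => by simp only [hΦ₁]; ring
  simp only [hsplit] at key
  rw [integral_sub i1 i2, integral_const_mul, Complex.sub_im, Complex.im_ofReal_mul,
    sub_eq_zero] at key
  rw [key, mul_left_comm, hEs, hc]
  field_simp

end IsRayAdmissible

/-! ### Riemann–Liouville derivatives through Laplace transforms -/

lemma laplace_rpow_neg {α s : ℝ} (hα : α < 1) (hs : 0 < s) :
    IntegrableOn (fun t : ℝ => Real.exp (-s * t) * t ^ (-α)) (Ioi 0) ∧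
    ∫ t in Ioi (0 : ℝ), Real.exp (-s * t) * t ^ (-α) = s ^ (α - 1) * Real.Gamma (1 - α) := by
  have h1 := Real.integral_rpow_mul_exp_neg_mul_Ioi (a := 1 - α) (by linarith) hs
  have h2 := integrableOn_rpow_mul_exp_neg_mul_rpow (s := -α) (p := 1) (b := s) (by linarith)
    one_pos hs
  refine ⟨?_, ?_⟩
  · refine h2.congr_fun (fun t _ => ?_) measurableSet_Ioi
    simp only [Real.rpow_one]
    ring
  · rw [one_div, Real.inv_rpow hs.le, ← Real.rpow_neg hs.le, neg_sub] at h1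
    rw [← h1]
    congr 1
    funext t
    rw [mul_comm, neg_mul, show 1 - α - 1 = -α by ring]

/-- Laplace transform of the Riemann–Liouville fractional integral. -/
lemma laplace_fractionalIntegral {f : ℝ → ℝ} {α s : ℝ} (hα : α < 1) (hs : 0 < s)
    (hf : IntegrableOn (fun t => Real.exp (-s * t) * f t) (Ioi 0)) :
    IntegrableOn (fun τ => Real.exp (-s * τ) * ∫ u in (0 : ℝ)..τ, f u * (τ - u) ^ (-α)) (Ioi 0) ∧
    ∫ τ in Ioi (0 : ℝ), Real.exp (-s * τ) * ∫ u in (0 : ℝ)..τ, f u * (τ - u) ^ (-α)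
      = (∫ t in Ioi (0 : ℝ), Real.exp (-s * t) * f t) * (s ^ (α - 1) * Real.Gamma (1 - α)) := by
  obtain ⟨hg, hgi⟩ := laplace_rpow_neg hα hs
  -- The weight splits as `exp(-sτ) = exp(-su) exp(-s(τ-u))`, so the weighted fractional integral is
  -- a convolution of two integrable functions.
  have hconv : ∀ τ : ℝ, ∫ u in (0 : ℝ)..τ, ContinuousLinearMap.mul ℝ ℝ
      (Real.exp (-s * u) * f u) (Real.exp (-s * (τ - u)) * (τ - u) ^ (-α))
      = Real.exp (-s * τ) * ∫ u in (0 : ℝ)..τ, f u * (τ - u) ^ (-α) := fun τ => by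
    rw [← intervalIntegral.integral_const_mul]
    congr 1
    funext u
    have : Real.exp (-s * τ) = Real.exp (-s * u) * Real.exp (-s * (τ - u)) := by
      rw [← Real.exp_add]; ring_nf
    rw [ContinuousLinearMap.mul_apply', this]
    ring
  constructor
  · have h := (integrable_posConvolution hf hg (ContinuousLinearMap.mul ℝ ℝ)).integrableOn
      (s := Ioi (0 : ℝ))
    refine h.congr_fun (fun τ hτ => ?_) measurableSet_Ioi
    rw [posConvolution, indicator_of_mem hτ]
    exact hconv τ
  · have h := integral_posConvolution hf hg (ContinuousLinearMap.mul ℝ ℝ)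
    simp only [hconv] at h
    rw [h, hgi, ContinuousLinearMap.mul_apply']

lemma intervalIntegrable_mul_sub_rpow_neg {f : ℝ → ℝ} {α K τ : ℝ} (hα : α < 1)
    (hf : ContinuousOn f (Ioi 0)) (hK : ∀ t, 0 < t → |f t| ≤ K) (hτ : 0 < τ) :
    IntervalIntegrable (fun u => f u * (τ - u) ^ (-α)) volume 0 τ := by
  have h1 : IntervalIntegrable (fun u => (τ - u) ^ (-α)) volume 0 τ := by
    have := (intervalIntegral.intervalIntegrable_rpow' (a := 0) (b := τ) (r := -α)
      (by linarith)).comp_sub_left τ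
    simpa using this.symm
  rw [intervalIntegrable_iff, uIoc_of_le hτ.le] at h1 ⊢
  refine Integrable.bdd_mul (c := K) h1 ?_ ?_
  · exact (hf.mono fun u hu => hu.1).aestronglyMeasurable measurableSet_Ioc
  · filter_upwards [ae_restrict_mem measurableSet_Ioc] with u hu
    exact hK u hu.1

/-- The substitution `u = τv` fixes the interval and moves the dependence on `τ` into `τ^(1-α)` and
`f(τv)`; the kernel `K(1-v)^(-α)` then dominates. -/
lemma continuousOn_fractionalIntegral {f : ℝ → ℝ} {α K : ℝ} (hα : α < 1)
    (hf : ContinuousOn f (Ioi 0)) (hK : ∀ t, 0 < t → |f t| ≤ K) :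
    ContinuousOn (fun τ => ∫ u in (0 : ℝ)..τ, f u * (τ - u) ^ (-α)) (Ioi 0) := by
  have hker : IntervalIntegrable (fun v : ℝ => K * (1 - v) ^ (-α)) volume 0 1 := by
    have := (intervalIntegral.intervalIntegrable_rpow' (a := 0) (b := 1) (r := -α)
      (by linarith)).comp_sub_left 1
    simpa using this.symm.const_mul K
  have heq : ∀ τ ∈ Ioi (0 : ℝ), ∫ u in (0 : ℝ)..τ, f u * (τ - u) ^ (-α)
      = τ ^ (1 - α) * ∫ v in (0 : ℝ)..1, f (τ * v) * (1 - v) ^ (-α) := by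
    intro τ hτ
    have hτ' : (0 : ℝ) < τ := hτ
    have h := intervalIntegral.smul_integral_comp_mul_left (a := 0) (b := 1)
      (fun u => f u * (τ - u) ^ (-α)) τ
    rw [mul_zero, mul_one] at h
    rw [← h, smul_eq_mul, sub_eq_add_neg, Real.rpow_add hτ', Real.rpow_one, mul_assoc,
      ← intervalIntegral.integral_const_mul (τ ^ (-α))]
    congr 1
    refine intervalIntegral.integral_congr fun v hv => ?_
    rw [uIcc_of_le zero_le_one] at hv
    have h1 : τ - τ * v = τ * (1 - v) := by ring
    rw [h1, Real.mul_rpow hτ'.le (by linarith [hv.2])]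
    ring
  refine ContinuousOn.congr ?_ heq
  refine ContinuousOn.mul (fun τ hτ => (Real.continuousAt_rpow_const _ _
    (Or.inl (ne_of_gt hτ))).continuousWithinAt) fun τ hτ => ?_
  have hmeas : ∀ σ : ℝ, 0 < σ → ContinuousOn (fun v => f (σ * v)) (Ioc 0 1) := fun σ hσ =>
    hf.comp (by fun_prop) fun v hv => mul_pos hσ hv.1
  refine intervalIntegral.continuousWithinAt_of_dominated_interval
    (bound := fun v => K * (1 - v) ^ (-α)) ?_ ?_ hker ?_
  · filter_upwards [self_mem_nhdsWithin] with σ hσ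
    rw [uIoc_of_le zero_le_one]
    refine ((hmeas σ hσ).aestronglyMeasurable measurableSet_Ioc).mul ?_
    exact (Measurable.pow_const (by fun_prop) _).aestronglyMeasurable
  · filter_upwards [self_mem_nhdsWithin] with σ hσ
    refine Eventually.of_forall fun v hv => ?_
    rw [uIoc_of_le zero_le_one] at hv
    have h1 : 0 ≤ (1 - v) ^ (-α) := Real.rpow_nonneg (by linarith [hv.2]) _
    rw [norm_mul, Real.norm_of_nonneg h1]
    exact mul_le_mul_of_nonneg_right (hK _ (mul_pos hσ hv.1)) h1
  · refine Eventually.of_forall fun v hv => ?_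
    rw [uIoc_of_le zero_le_one] at hv
    refine ContinuousWithinAt.mul ?_ continuousWithinAt_const
    have hpos : 0 < τ * v := mul_pos hτ hv.1
    have : ContinuousAt f (τ * v) := hf.continuousAt (Ioi_mem_nhds hpos)
    exact (ContinuousAt.comp (f := fun σ => σ * v) this (by fun_prop)).continuousWithinAt

/-- The Riemann–Liouville derivative of `f` is `g` if the Laplace transforms satisfy
`ĝ(s) = s ^ α * f̂(s)`. -/
theorem hasRLDerivAt_of_laplace {f g : ℝ → ℝ} {α K : ℝ} (hα1 : α < 1)
    (hf : ContinuousOn f (Ioi 0)) (hfK : ∀ t, 0 < t → |f t| ≤ K)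
    (hg : ContinuousOn g (Ioi 0)) (hgK : ∀ t, 0 < t → |g t| ≤ K)
    (hfi : ∀ s, 0 < s → IntegrableOn (fun t => Real.exp (-s * t) * f t) (Ioi 0))
    (hgi : ∀ s, 0 < s → IntegrableOn (fun t => Real.exp (-s * t) * g t) (Ioi 0))
    (hfg : ∀ s, 0 < s → ∫ t in Ioi (0 : ℝ), Real.exp (-s * t) * g t
      = s ^ α * ∫ t in Ioi (0 : ℝ), Real.exp (-s * t) * f t) {t : ℝ} (ht : 0 < t) :
    HasRLDerivAt α f (g t) t := by
  refine ⟨?_, ?_⟩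
  · filter_upwards [Ioi_mem_nhds ht] with τ hτ
    exact intervalIntegrable_mul_sub_rpow_neg hα1 hf hfK hτ
  have hΓ : Real.Gamma (1 - α) ≠ 0 := (Real.Gamma_pos_of_pos (by linarith)).ne'
  -- The ordinary primitive is the fractional integral with exponent `0`, so the same lemmas cover
  -- both sides.
  have hg0 : ∀ τ : ℝ, ∫ u in (0 : ℝ)..τ, g u * (τ - u) ^ (-(0 : ℝ)) = ∫ u in (0 : ℝ)..τ, g u :=
    fun τ => by simp
  have hc1 : ContinuousOn (fun τ => 1 / Real.Gamma (1 - α)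
      * ∫ u in (0 : ℝ)..τ, f u * (τ - u) ^ (-α)) (Ioi 0) :=
    continuousOn_const.mul (continuousOn_fractionalIntegral hα1 hf hfK)
  have hc2 : ContinuousOn (fun τ => ∫ u in (0 : ℝ)..τ, g u) (Ioi 0) := by
    have := continuousOn_fractionalIntegral zero_lt_one hg hgK
    simpa only [hg0] using this
  -- Integrated form of the claim: `s^(α-1) f̂(s) = ĝ(s)/s`. Both sides are continuous in `τ`, so
  -- they agree everywhere and can be differentiated.
  have hae := ae_eq_of_laplace_eq (s₀ := 0)
    (f := fun τ => 1 / Real.Gamma (1 - α) * ∫ u in (0 : ℝ)..τ, f u * (τ - u) ^ (-α))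
    (g := fun τ => ∫ u in (0 : ℝ)..τ, g u) ?_ ?_ ?_
  · have heq := Measure.eqOn_open_of_ae_eq hae isOpen_Ioi hc1 hc2
    have hgint : IntervalIntegrable g volume 0 t := by
      have := intervalIntegrable_mul_sub_rpow_neg zero_lt_one hg hgK ht
      simpa using this
    have hd : HasDerivAt (fun τ => ∫ u in (0 : ℝ)..τ, g u) (g t) t :=
      intervalIntegral.integral_hasDerivAt_right hgint
        (hg.stronglyMeasurableAtFilter isOpen_Ioi t ht) (hg.continuousAt (Ioi_mem_nhds ht))
    refine hd.congr_of_eventuallyEq ?_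
    filter_upwards [Ioi_mem_nhds ht] with τ hτ
    exact heq hτ
  · intro s hs
    refine ((laplace_fractionalIntegral hα1 hs (hfi s hs)).1.const_mul
      (1 / Real.Gamma (1 - α))).congr (Eventually.of_forall fun τ => ?_)
    simp only
    ring
  · intro s hs
    have := (laplace_fractionalIntegral zero_lt_one hs (hgi s hs)).1
    simpa only [hg0] using this
  · intro s hs
    have h1 := (laplace_fractionalIntegral hα1 hs (hfi s hs)).2
    have h2 := (laplace_fractionalIntegral zero_lt_one hs (hgi s hs)).2
    simp only [hg0] at h2
    rw [h2, hfg s hs]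
    simp_rw [mul_left_comm _ (1 / Real.Gamma (1 - α))]
    rw [integral_const_mul, h1, sub_zero, Real.Gamma_one, Real.rpow_sub hs, Real.rpow_one,
      zero_sub, Real.rpow_neg_one]
    field_simp

/-! ### Bounds and continuity of ray transforms -/

section RayTransformRegularity

variable {θ : ℝ}

lemma abs_rayTransform_le (h₁ : Real.pi / 2 < θ) (h₂ : θ < Real.pi) {Φ : ℂ → ℂ}
    (hi : Integrable fun u : ℝ => ‖Φ (u + θ * Complex.I)‖) {t : ℝ} (ht : 0 ≤ t) :
    |rayTransform θ Φ t| ≤ 1 / Real.pi * ∫ u : ℝ, ‖Φ (u + θ * Complex.I)‖ := by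
  have hκ := neg_cos_pos h₁ h₂
  rw [rayTransform, abs_mul, abs_of_nonneg (by positivity : 0 ≤ 1 / Real.pi)]
  gcongr
  refine (Complex.abs_im_le_norm _).trans (norm_integral_le_of_norm_le hi
    (Eventually.of_forall fun u => ?_))
  rw [norm_mul, norm_cexp_mul_cexp]
  refine mul_le_of_le_one_left (norm_nonneg _) ?_
  rw [Real.exp_le_one_iff]
  have : 0 ≤ t * (Real.exp u * -Real.cos θ) := by positivity
  linarith

lemma integrable_exp_add_exp_mul_exp_neg {a b C q : ℝ} (ha : 0 < a) (hb : 0 < b) (hq : 0 < q) :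
    Integrable fun u : ℝ => C * (Real.exp (a * u) + Real.exp (b * u))
      * Real.exp (-q * Real.exp u) := by
  have h1 := integrable_exp_mul_mul_exp_neg_mul_exp ha hq one_pos
  have h2 := integrable_exp_mul_mul_exp_neg_mul_exp hb hq one_pos
  refine ((h1.add h2).const_mul C).congr (Eventually.of_forall fun u => ?_)
  simp only [one_mul, Pi.add_apply]
  ring

lemma norm_rayIntegrand_le {Φ : ℂ → ℂ} {B u t t₀ : ℝ} (hκ : 0 < -Real.cos θ)
    (hB : ‖Φ (u + θ * Complex.I)‖ ≤ B) (ht : t₀ ≤ t) :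
    ‖Complex.exp (t * Complex.exp (u + θ * Complex.I)) * Φ (u + θ * Complex.I)‖
      ≤ B * Real.exp (-(t₀ * -Real.cos θ) * Real.exp u) := by
  rw [norm_mul, norm_cexp_mul_cexp, mul_comm]
  refine mul_le_mul hB (Real.exp_le_exp.2 ?_) (Real.exp_pos _).le ((norm_nonneg _).trans hB)
  have : t₀ * (-Real.cos θ * Real.exp u) ≤ t * (-Real.cos θ * Real.exp u) := by
    gcongr
  linarith

/-- Joint continuity of a family of ray transforms in the parameter and the time. -/
lemma continuousOn_rayTransform {X : Type*} [TopologicalSpace X] [FirstCountableTopology X]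
    (h₁ : Real.pi / 2 < θ) (h₂ : θ < Real.pi) {Φ : X → ℂ → ℂ} {S : Set X} {a b C : ℝ}
    (ha : 0 < a) (hb : 0 < b) (hc : ∀ x ∈ S, Continuous (Φ x))
    (hbd : ∀ x ∈ S, ∀ u : ℝ, ‖Φ x (u + θ * Complex.I)‖
      ≤ C * (Real.exp (a * u) + Real.exp (b * u)))
    (hx : ∀ u : ℝ, ContinuousOn (fun x => Φ x (u + θ * Complex.I)) S) :
    ContinuousOn (fun p : X × ℝ => rayTransform θ (Φ p.1) p.2) (S ×ˢ Ioi 0) := by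
  have hκ := neg_cos_pos h₁ h₂
  rintro ⟨x, t⟩ ⟨hxS, ht⟩
  have ht' : 0 < t := ht
  unfold rayTransform
  refine continuousWithinAt_const.mul (Complex.continuous_im.continuousAt.comp_continuousWithinAt ?_)
  -- Staying above `t/2` keeps a fixed decay rate of `exp(tz)` near `t`.
  have hev : ∀ᶠ p : X × ℝ in 𝓝[S ×ˢ Ioi 0] (x, t), p.1 ∈ S ∧ t / 2 ≤ p.2 := by
    have h3 : ∀ᶠ p : X × ℝ in 𝓝 (x, t), t / 2 ≤ p.2 :=
      continuous_snd.continuousAt.eventually (Ici_mem_nhds (by linarith : t / 2 < t))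
    filter_upwards [self_mem_nhdsWithin, nhdsWithin_le_nhds h3] with p hp hp2
    exact ⟨hp.1, hp2⟩
  refine continuousWithinAt_of_dominated
    (bound := fun u => C * (Real.exp (a * u) + Real.exp (b * u))
      * Real.exp (-(t / 2 * -Real.cos θ) * Real.exp u)) ?_ ?_
    (integrable_exp_add_exp_mul_exp_neg ha hb (by positivity)) ?_
  · filter_upwards [hev] with p hp
    have := hc p.1 hp.1
    exact Continuous.aestronglyMeasurable (by fun_prop)
  · filter_upwards [hev] with p hp
    exact Eventually.of_forall fun u => norm_rayIntegrand_le hκ (hbd p.1 hp.1 u) hp.2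
  · refine Eventually.of_forall fun u => ?_
    refine ContinuousWithinAt.mul (Continuous.continuousWithinAt (by fun_prop)) ?_
    exact ContinuousWithinAt.comp (x := (x, t)) (f := Prod.fst) (t := S) (hx u x hxS)
      continuousWithinAt_fst fun p hp => hp.1

end RayTransformRegularity

/-! ### The Laplace exponent on the sector -/

/-- The Laplace exponent `z ^ (2ν) + 2λ z ^ ν` in the logarithmic coordinate `z = exp w`. -/
noncomputable def logSymbol (ν lam : ℝ) (w : ℂ) : ℂ :=
  Complex.exp ((2 * ν : ℝ) * w) + 2 * lam * Complex.exp (ν * w)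

/-- The opening of the integration ray. -/
noncomputable def rayAngle (ν : ℝ) : ℝ := Real.pi / (1 + 2 * ν)

/-- The function inverted along the ray to obtain the density of the inverse process at `x`. -/
noncomputable def densityKernel (ν lam x : ℝ) (w : ℂ) : ℂ :=
  logSymbol ν lam w * Complex.exp (-x * logSymbol ν lam w)

/-- The density of the inverse process. -/
noncomputable def inverseDensity (ν lam x t : ℝ) : ℝ :=
  rayTransform (rayAngle ν) (densityKernel ν lam x) t

section Symbol

variable {ν lam : ℝ}

lemma pi_div_two_lt_rayAngle (hν0 : 0 < ν) (hν : ν < 1 / 2) : Real.pi / 2 < rayAngle ν :=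
  div_lt_div_of_pos_left Real.pi_pos (by linarith) (by linarith)

lemma rayAngle_lt_pi (hν0 : 0 < ν) : rayAngle ν < Real.pi :=
  div_lt_self Real.pi_pos (by linarith)

/-- The angle is chosen so that `θ + 2νθ = π`; hence `θ > π/2` and `2νθ < π/2` are the same
condition `2ν < 1`. -/
lemma two_mul_mul_rayAngle_le (hν0 : 0 < ν) (hν : ν < 1 / 2) :
    2 * ν * rayAngle ν ≤ Real.pi / 2 := by
  rw [rayAngle, ← mul_div_assoc, div_le_iff₀ (by linarith)]
  nlinarith [Real.pi_pos]

lemma cos_mul_rayAngle_pos (hν0 : 0 < ν) (hν : ν < 1 / 2) : 0 < Real.cos (ν * rayAngle ν) := by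
  have h1 := two_mul_mul_rayAngle_le hν0 hν
  have h2 : 0 < ν * rayAngle ν :=
    mul_pos hν0 (by linarith [pi_div_two_lt_rayAngle hν0 hν, Real.pi_pos])
  exact Real.cos_pos_of_mem_Ioo ⟨by linarith, by linarith⟩

@[fun_prop]
lemma differentiable_logSymbol : Differentiable ℂ (logSymbol ν lam) := by
  unfold logSymbol
  fun_prop

@[fun_prop]
lemma continuous_logSymbol : Continuous (logSymbol ν lam) :=
  differentiable_logSymbol.continuous

lemma logSymbol_ofReal (u : ℝ) : logSymbol ν lam u
    = ((Real.exp (2 * ν * u) + 2 * lam * Real.exp (ν * u) : ℝ) : ℂ) := by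
  simp [logSymbol]

lemma logSymbol_log {s : ℝ} (hs : 0 < s) : logSymbol ν lam (Real.log s)
    = ((s ^ (2 * ν) + 2 * lam * s ^ ν : ℝ) : ℂ) := by
  rw [logSymbol_ofReal, Real.rpow_def_of_pos hs, Real.rpow_def_of_pos hs, mul_comm (Real.log s),
    mul_comm (Real.log s)]

lemma norm_logSymbol_le (hlam : 0 < lam) (u y : ℝ) : ‖logSymbol ν lam (u + y * Complex.I)‖
    ≤ Real.exp (2 * ν * u) + 2 * lam * Real.exp (ν * u) := by
  refine (norm_add_le _ _).trans (le_of_eq ?_)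
  simp [Complex.norm_exp, abs_of_pos hlam]

/-- On the sector `z^(2ν)` has nonnegative real part, while `Re z^ν ≥ cos(νθ) |z|^ν`. The second
term alone yields the decay of `exp(-xΨ)`. -/
lemma le_re_logSymbol (hν0 : 0 < ν) (hν : ν < 1 / 2) (hlam : 0 < lam) (u : ℝ) {y : ℝ}
    (hy : y ∈ Icc 0 (rayAngle ν)) :
    2 * lam * Real.cos (ν * rayAngle ν) * Real.exp (ν * u)
      ≤ (logSymbol ν lam (u + y * Complex.I)).re := by
  have h1 := two_mul_mul_rayAngle_le hν0 hν
  have hre : (logSymbol ν lam (u + y * Complex.I)).re = Real.exp (2 * ν * u) * Real.cos (2 * ν * y)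
      + 2 * lam * (Real.exp (ν * u) * Real.cos (ν * y)) := by
    simp [logSymbol, Complex.exp_re, mul_assoc]
  have hνy : 2 * ν * y ≤ 2 * ν * rayAngle ν := by gcongr; exact hy.2
  have hνy0 : 0 ≤ ν * y := mul_nonneg hν0.le hy.1
  have hc1 : 0 ≤ Real.cos (2 * ν * y) :=
    Real.cos_nonneg_of_mem_Icc ⟨by linarith [Real.pi_pos], by linarith⟩
  have hc2 : Real.cos (ν * rayAngle ν) ≤ Real.cos (ν * y) :=
    Real.cos_le_cos_of_nonneg_of_le_pi hνy0 (by linarith [Real.pi_pos]) (by linarith)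
  rw [hre]
  have h2 : 2 * lam * Real.exp (ν * u) * Real.cos (ν * rayAngle ν)
      ≤ 2 * lam * Real.exp (ν * u) * Real.cos (ν * y) := by gcongr
  have h3 : 0 ≤ Real.exp (2 * ν * u) * Real.cos (2 * ν * y) := by positivity
  linarith

lemma norm_cexp_neg_mul_logSymbol_le (hν0 : 0 < ν) (hν : ν < 1 / 2) (hlam : 0 < lam) {x : ℝ}
    (hx : 0 ≤ x) (u : ℝ) {y : ℝ} (hy : y ∈ Icc 0 (rayAngle ν)) :
    ‖Complex.exp (-x * logSymbol ν lam (u + y * Complex.I))‖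
      ≤ Real.exp (-(x * (2 * lam * Real.cos (ν * rayAngle ν))) * Real.exp (ν * u)) := by
  rw [Complex.norm_exp, ← Complex.ofReal_neg, Complex.re_ofReal_mul, Real.exp_le_exp]
  have := mul_le_mul_of_nonneg_left (le_re_logSymbol hν0 hν hlam u hy) hx
  linarith

lemma norm_cexp_neg_mul_logSymbol_le_one (hν0 : 0 < ν) (hν : ν < 1 / 2) (hlam : 0 < lam) {x : ℝ}
    (hx : 0 ≤ x) (u : ℝ) {y : ℝ} (hy : y ∈ Icc 0 (rayAngle ν)) :
    ‖Complex.exp (-x * logSymbol ν lam (u + y * Complex.I))‖ ≤ 1 := by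
  refine (norm_cexp_neg_mul_logSymbol_le hν0 hν hlam hx u hy).trans ?_
  rw [Real.exp_le_one_iff]
  have hc := cos_mul_rayAngle_pos hν0 hν
  have : 0 ≤ x * (2 * lam * Real.cos (ν * rayAngle ν)) * Real.exp (ν * u) := by positivity
  linarith

lemma densityKernel_ofReal_im (x u : ℝ) : (densityKernel ν lam x u).im = 0 := by
  rw [densityKernel, logSymbol_ofReal, ← Complex.ofReal_neg, ← Complex.ofReal_mul,
    ← Complex.ofReal_exp, ← Complex.ofReal_mul, Complex.ofReal_im]

lemma densityKernel_log_re (x : ℝ) {s : ℝ} (hs : 0 < s) :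
    (densityKernel ν lam x (Real.log s)).re = (s ^ (2 * ν) + 2 * lam * s ^ ν)
      * Real.exp (-x * (s ^ (2 * ν) + 2 * lam * s ^ ν)) := by
  rw [densityKernel, logSymbol_log hs, ← Complex.ofReal_neg, ← Complex.ofReal_mul,
    ← Complex.ofReal_exp, ← Complex.ofReal_mul, Complex.ofReal_re]

@[fun_prop]
lemma differentiable_densityKernel (x : ℝ) : Differentiable ℂ (densityKernel ν lam x) := by
  unfold densityKernel
  fun_prop

lemma isRayAdmissible_densityKernel (hν0 : 0 < ν) (hν : ν < 1 / 2) (hlam : 0 < lam) {x : ℝ}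
    (hx : 0 ≤ x) :
    IsRayAdmissible (rayAngle ν) (2 * ν) ν (1 + 2 * lam) (densityKernel ν lam x) where
  differentiable := differentiable_densityKernel x
  im_eq_zero := densityKernel_ofReal_im x
  bound u y hy := by
    rw [densityKernel, norm_mul]
    have h1 := norm_logSymbol_le (ν := ν) hlam u y
    have h2 := norm_cexp_neg_mul_logSymbol_le_one hν0 hν hlam hx u hy
    refine (mul_le_of_le_one_right (norm_nonneg _) h2).trans (h1.trans ?_)
    nlinarith [Real.exp_pos (2 * ν * u), Real.exp_pos (ν * u)]

lemma exists_exp_mul_mul_exp_neg_le {p b q : ℝ} (hp : 0 < p) (hb : 0 < b) (hq : 0 < q) :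
    ∃ K, 0 ≤ K ∧ ∀ u : ℝ, Real.exp (p * u) * Real.exp (-b * Real.exp (q * u)) ≤ K := by
  refine ⟨Real.exp (-(p / q * (Real.log (b * q / p) + 1))), (Real.exp_pos _).le, fun u => ?_⟩
  rw [← Real.exp_add, Real.exp_le_exp]
  -- The tangent line of `exp` is taken at the point corresponding to the maximum of `pu - b
  -- exp(qu)`, where `exp(qu) = p/(bq)`.
  have h := Real.add_one_le_exp (q * u + Real.log (b * q / p))
  rw [Real.exp_add, Real.exp_log (by positivity)] at h
  have h2 := mul_le_mul_of_nonneg_left h (by positivity : 0 ≤ p / q)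
  have h3 : p / q * (Real.exp (q * u) * (b * q / p)) = b * Real.exp (q * u) := by
    field_simp
  have h4 : p / q * (q * u + Real.log (b * q / p) + 1)
      = p * u + p / q * (Real.log (b * q / p) + 1) := by
    field_simp
    ring
  rw [h3, h4] at h2
  linarith

/-- For `x > 0` the kernel decays on the strip faster than any power of `exp (Re w)`. -/
lemma exists_isRayAdmissible_cexp_mul_densityKernel (hν0 : 0 < ν) (hν : ν < 1 / 2)
    (hlam : 0 < lam) {x : ℝ} (hx : 0 < x) {α : ℝ} (hα : 0 < α) :
    ∃ C, IsRayAdmissible (rayAngle ν) ν ν C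
      fun w => Complex.exp (α * w) * densityKernel ν lam x w := by
  have hc := cos_mul_rayAngle_pos hν0 hν
  set b := x * (2 * lam * Real.cos (ν * rayAngle ν)) with hb
  have hb0 : 0 < b := by positivity
  obtain ⟨K₁, hK₁, h₁⟩ := exists_exp_mul_mul_exp_neg_le (add_pos hα hν0) hb0 hν0
  obtain ⟨K₂, hK₂, h₂⟩ := exists_exp_mul_mul_exp_neg_le hα hb0 hν0
  refine ⟨K₁ + 2 * lam * K₂, by fun_prop, fun u => ?_, fun u y hy => ?_⟩
  · rw [← Complex.ofReal_mul, ← Complex.ofReal_exp, Complex.im_ofReal_mul,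
      densityKernel_ofReal_im, mul_zero]
  · have e1 := norm_logSymbol_le (ν := ν) hlam u y
    have e2 := norm_cexp_neg_mul_logSymbol_le hν0 hν hlam hx.le u hy
    have e3 : ‖Complex.exp (α * (u + y * Complex.I))‖ = Real.exp (α * u) := by
      simp [Complex.norm_exp]
    rw [norm_mul, densityKernel, norm_mul, e3]
    calc Real.exp (α * u) * (‖logSymbol ν lam (u + y * Complex.I)‖
          * ‖Complex.exp (-x * logSymbol ν lam (u + y * Complex.I))‖)
        ≤ Real.exp (α * u) * ((Real.exp (2 * ν * u) + 2 * lam * Real.exp (ν * u))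
          * Real.exp (-b * Real.exp (ν * u))) := by gcongr
      -- One factor `exp(νu)` is kept as admissible growth and the decay absorbs the rest, so the
      -- exponents do not depend on `α`.
      _ = (Real.exp ((α + ν) * u) * Real.exp (-b * Real.exp (ν * u))
          + 2 * lam * (Real.exp (α * u) * Real.exp (-b * Real.exp (ν * u))))
            * Real.exp (ν * u) := by
          rw [add_mul α, Real.exp_add, show 2 * ν * u = ν * u + ν * u by ring, Real.exp_add]
          ring
      _ ≤ (K₁ + 2 * lam * K₂) * Real.exp (ν * u) := by
          gcongr
          · exact h₁ u
          · exact h₂ u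
      _ ≤ (K₁ + 2 * lam * K₂) * (Real.exp (ν * u) + Real.exp (ν * u)) := by
          gcongr
          linarith [Real.exp_pos (ν * u)]

/-- For `x > 0` the factor `exp(-xΨ)` gives integrability without help from `exp(tz)`. This bounds
the ray transform uniformly down to `t = 0`. -/
lemma integrable_norm_cexp_mul_densityKernel (hν0 : 0 < ν) (hν : ν < 1 / 2)
    (hlam : 0 < lam) {x : ℝ} (hx : 0 < x) {α : ℝ} (hα : 0 ≤ α) :
    Integrable fun u : ℝ => ‖Complex.exp (α * (u + rayAngle ν * Complex.I))
      * densityKernel ν lam x (u + rayAngle ν * Complex.I)‖ := by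
  have hc := cos_mul_rayAngle_pos hν0 hν
  set b := x * (2 * lam * Real.cos (ν * rayAngle ν)) with hb
  have hb0 : 0 < b := by positivity
  have i1 := integrable_exp_mul_mul_exp_neg_mul_exp (a := α + 2 * ν) (by linarith) hb0 hν0
  have i2 := integrable_exp_mul_mul_exp_neg_mul_exp (a := α + ν) (by linarith) hb0 hν0
  have hcont := (differentiable_densityKernel (ν := ν) (lam := lam) x).continuous
  refine (i1.add (i2.const_mul (2 * lam))).mono' (by fun_prop) (Eventually.of_forall fun u => ?_)
  have hθ : rayAngle ν ∈ Icc 0 (rayAngle ν) :=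
    ⟨by linarith [pi_div_two_lt_rayAngle hν0 hν, Real.pi_pos], le_rfl⟩
  have e1 := norm_logSymbol_le (ν := ν) hlam u (rayAngle ν)
  have e2 := norm_cexp_neg_mul_logSymbol_le hν0 hν hlam hx.le u hθ
  have e3 : ‖Complex.exp (α * (u + rayAngle ν * Complex.I))‖ = Real.exp (α * u) := by
    simp [Complex.norm_exp]
  rw [norm_norm, norm_mul, densityKernel, norm_mul, e3]
  calc Real.exp (α * u) * (‖logSymbol ν lam (u + rayAngle ν * Complex.I)‖
        * ‖Complex.exp (-x * logSymbol ν lam (u + rayAngle ν * Complex.I))‖)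
      ≤ Real.exp (α * u) * ((Real.exp (2 * ν * u) + 2 * lam * Real.exp (ν * u))
        * Real.exp (-b * Real.exp (ν * u))) := by gcongr
    _ = _ := by
        simp only [Pi.add_apply]
        rw [add_mul α, Real.exp_add, add_mul α, Real.exp_add]
        ring

end Symbol

/-! ### The candidate density and its equation -/

section Density

variable {ν lam : ℝ}

lemma rayTransform_add_ofReal_mul {θ t : ℝ} {Φ₁ Φ₂ : ℂ → ℂ} (c : ℝ)
    (hi₁ : Integrable fun u : ℝ => Complex.exp (t * Complex.exp (u + θ * Complex.I))
      * Φ₁ (u + θ * Complex.I))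
    (hi₂ : Integrable fun u : ℝ => Complex.exp (t * Complex.exp (u + θ * Complex.I))
      * Φ₂ (u + θ * Complex.I)) :
    rayTransform θ (fun w => Φ₁ w + c * Φ₂ w) t
      = rayTransform θ Φ₁ t + c * rayTransform θ Φ₂ t := by
  unfold rayTransform
  simp_rw [mul_add, mul_left_comm _ (c : ℂ)]
  rw [integral_add hi₁ (hi₂.const_mul _), integral_const_mul, Complex.add_im,
    Complex.im_ofReal_mul]
  ring

lemma continuousOn_inverseDensity (hν0 : 0 < ν) (hν : ν < 1 / 2) (hlam : 0 < lam) :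
    ContinuousOn (fun p : ℝ × ℝ => inverseDensity ν lam p.1 p.2) (Ici 0 ×ˢ Ioi 0) := by
  have h₁ := pi_div_two_lt_rayAngle hν0 hν
  refine continuousOn_rayTransform h₁ (rayAngle_lt_pi hν0) (by linarith : 0 < 2 * ν) hν0
    (fun x _ => (differentiable_densityKernel x).continuous) (fun x hx u =>
    (isRayAdmissible_densityKernel hν0 hν hlam hx).bound u _
      ⟨by linarith [Real.pi_pos], le_rfl⟩) fun u => ?_
  unfold densityKernel
  fun_prop

lemma continuousOn_inverseDensity_left (hν0 : 0 < ν) (hν : ν < 1 / 2) (hlam : 0 < lam) {t : ℝ}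
    (ht : 0 < t) : ContinuousOn (fun x => inverseDensity ν lam x t) (Ici 0) :=
  (continuousOn_inverseDensity hν0 hν hlam).comp (f := fun x => (x, t)) (by fun_prop)
    fun _ hx => ⟨hx, ht⟩

lemma continuousOn_inverseDensity_right (hν0 : 0 < ν) (hν : ν < 1 / 2) (hlam : 0 < lam) {x : ℝ}
    (hx : 0 ≤ x) : ContinuousOn (fun t => inverseDensity ν lam x t) (Ioi 0) :=
  (continuousOn_inverseDensity hν0 hν hlam).comp (f := fun t => (x, t)) (by fun_prop)
    fun _ ht => ⟨hx, ht⟩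

/-- Laplace transform of the density in time, with a bound that is uniform in `x`. -/
lemma laplace_inverseDensity (hν0 : 0 < ν) (hν : ν < 1 / 2) (hlam : 0 < lam) {s : ℝ}
    (hs : 0 < s) :
    (∃ B, ∀ x, 0 ≤ x → ∫ t in Ioi (0 : ℝ), ‖Real.exp (-s * t) * inverseDensity ν lam x t‖ ≤ B) ∧
    ∀ x, 0 ≤ x →
      IntegrableOn (fun t => Real.exp (-s * t) * inverseDensity ν lam x t) (Ioi 0) ∧
      ∫ t in Ioi (0 : ℝ), Real.exp (-s * t) * inverseDensity ν lam x t
        = (s ^ (2 * ν) + 2 * lam * s ^ ν)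
          * Real.exp (-x * (s ^ (2 * ν) + 2 * lam * s ^ ν)) / s := by
  have h₁ := pi_div_two_lt_rayAngle hν0 hν
  have h₂ := rayAngle_lt_pi hν0
  have ha : 2 * ν ∈ Ioo (0 : ℝ) 1 := ⟨by linarith, by linarith⟩
  have hb : ν ∈ Ioo (0 : ℝ) 1 := ⟨hν0, by linarith⟩
  have hκ := neg_cos_pos h₁ h₂
  have hθ : rayAngle ν ∈ Icc 0 (rayAngle ν) := ⟨by linarith [Real.pi_pos], le_rfl⟩
  constructor
  · have i1 := (integrable_exp_mul_div_add ha.1 ha.2 hs hκ).add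
      (integrable_exp_mul_div_add hb.1 hb.2 hs hκ)
    refine ⟨1 / Real.pi * ∫ u : ℝ, (1 + 2 * lam) * (Real.exp (2 * ν * u)
      / (s + -Real.cos (rayAngle ν) * Real.exp u)
      + Real.exp (ν * u) / (s + -Real.cos (rayAngle ν) * Real.exp u)), fun x hx => ?_⟩
    have hadm := isRayAdmissible_densityKernel hν0 hν hlam hx
    have hint := hadm.integrable_norm_div h₁ h₂ ha hb hs
    refine (laplace_rayTransform_fubini h₁ h₂ hadm.differentiable.continuous hs hint).2.1.trans ?_
    refine mul_le_mul_of_nonneg_left ?_ (by positivity)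
    refine integral_mono hint (i1.const_mul _) fun u => ?_
    simp only
    rw [← add_div, ← mul_div_assoc]
    have := hadm.bound u _ hθ
    gcongr
  · intro x hx
    have hadm := isRayAdmissible_densityKernel hν0 hν hlam hx
    have hint := hadm.integrable_norm_div h₁ h₂ ha hb hs
    refine ⟨(laplace_rayTransform_fubini h₁ h₂ hadm.differentiable.continuous hs hint).1, ?_⟩
    rw [← densityKernel_log_re x hs]
    exact hadm.laplace_rayTransform h₁ h₂ ha hb hs

/-- At `x = 0` the kernel is `exp(2νw) + 2λ exp(νw)`, and each term is evaluated by
`rayTransform_cexp`. -/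
lemma inverseDensity_zero (hν0 : 0 < ν) (hν : ν < 1 / 2) {t : ℝ} (ht : 0 < t) :
    inverseDensity ν lam 0 t = t ^ (-(2 * ν)) / Real.Gamma (1 - 2 * ν)
      + 2 * lam * (t ^ (-ν) / Real.Gamma (1 - ν)) := by
  have h₁ := pi_div_two_lt_rayAngle hν0 hν
  have h₂ := rayAngle_lt_pi hν0
  have hκ := neg_cos_pos h₁ h₂
  rw [← rayTransform_cexp h₁ h₂ (by linarith : 0 < 2 * ν) ht, ← rayTransform_cexp h₁ h₂ hν0 ht]
  have hi : ∀ a : ℝ, 0 < a → Integrable fun u : ℝ => Complex.exp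
      (t * Complex.exp (u + rayAngle ν * Complex.I))
        * Complex.exp (a * (u + rayAngle ν * Complex.I)) := fun a ha => by
    have := integrable_exp_mul_mul_exp_neg_mul_exp ha (mul_pos ht hκ) one_pos
    simp only [one_mul] at this
    refine this.mono' (by fun_prop) (Eventually.of_forall fun u => ?_)
    refine norm_rayIntegrand_le (Φ := fun w => Complex.exp (a * w)) hκ ?_ le_rfl
    simp [Complex.norm_exp]
  have hsum := rayTransform_add_ofReal_mul (Φ₁ := fun w => Complex.exp ((2 * ν : ℝ) * w))
    (Φ₂ := fun w => Complex.exp (ν * w)) (2 * lam) (hi _ (by linarith)) (hi ν hν0)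
  have hfun : (fun w => Complex.exp ((2 * ν : ℝ) * w) + (2 * lam : ℝ) * Complex.exp (ν * w))
      = densityKernel ν lam 0 := by
    funext w
    simp [densityKernel, logSymbol]
  rw [hfun] at hsum
  exact hsum

lemma hasDerivAt_inverseDensity (hν0 : 0 < ν) (hν : ν < 1 / 2) (hlam : 0 < lam) {x t : ℝ}
    (hx : 0 < x) (ht : 0 < t) :
    HasDerivAt (fun y => inverseDensity ν lam y t)
      (-rayTransform (rayAngle ν) (fun w => logSymbol ν lam w * densityKernel ν lam x w) t) x := by
  have h₁ := pi_div_two_lt_rayAngle hν0 hν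
  have h₂ := rayAngle_lt_pi hν0
  have hκ := neg_cos_pos h₁ h₂
  have hθ : rayAngle ν ∈ Icc 0 (rayAngle ν) := ⟨by linarith [Real.pi_pos], le_rfl⟩
  have hq : 0 < t * -Real.cos (rayAngle ν) := by positivity
  have hd := hasDerivAt_integral_of_dominated_loc_of_deriv_le (s := Ioi 0) (x₀ := x) (μ := volume)
    (F := fun (y u : ℝ) => Complex.exp (t * Complex.exp (u + rayAngle ν * Complex.I))
      * densityKernel ν lam y (u + rayAngle ν * Complex.I))
    (F' := fun (y u : ℝ) => Complex.exp (t * Complex.exp (u + rayAngle ν * Complex.I))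
      * -(logSymbol ν lam (u + rayAngle ν * Complex.I)
        * densityKernel ν lam y (u + rayAngle ν * Complex.I)))
    -- The constant comes from `(p + q)² ≤ 2p² + 2q²` with `p = exp(2νu)` and `q = 2λ exp(νu)`,
    -- which bounds `|Ψ|²`.
    (bound := fun u => (2 + 8 * lam ^ 2) * (Real.exp (4 * ν * u) + Real.exp (2 * ν * u))
      * Real.exp (-(t * -Real.cos (rayAngle ν)) * Real.exp u))
    (Ioi_mem_nhds hx) ?_ ?_ ?_ ?_
    (integrable_exp_add_exp_mul_exp_neg (by linarith) (by linarith) hq) ?_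
  · have h := (hasDerivAt_const x (1 / Real.pi)).mul
      (Complex.imCLM.hasFDerivAt.comp_hasDerivAt x hd.2)
    refine h.congr_deriv ?_
    simp only [zero_mul, zero_add, Complex.imCLM_apply, rayTransform, mul_neg]
    rw [integral_neg, Complex.neg_im]
    ring
  · refine Eventually.of_forall fun y => ?_
    have := (differentiable_densityKernel (ν := ν) (lam := lam) y).continuous
    exact Continuous.aestronglyMeasurable (by fun_prop)
  · have hadm := isRayAdmissible_densityKernel hν0 hν hlam hx.le
    have := hadm.differentiable.continuous
    refine (integrable_exp_add_exp_mul_exp_neg (by linarith : 0 < 2 * ν) hν0 hq).mono'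
      (by fun_prop) (Eventually.of_forall fun u => norm_rayIntegrand_le hκ
        (hadm.bound u _ hθ) le_rfl)
  · have := (differentiable_densityKernel (ν := ν) (lam := lam) x).continuous
    exact Continuous.aestronglyMeasurable (by fun_prop)
  · refine Eventually.of_forall fun u y hy => ?_
    refine norm_rayIntegrand_le
      (Φ := fun w => -(logSymbol ν lam w * densityKernel ν lam y w)) hκ ?_ le_rfl
    have e1 := norm_logSymbol_le (ν := ν) hlam u (rayAngle ν)
    have e2 := norm_cexp_neg_mul_logSymbol_le_one hν0 hν hlam (le_of_lt hy) u hθ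
    rw [norm_neg, norm_mul, densityKernel, norm_mul, ← mul_assoc]
    refine (mul_le_of_le_one_right (by positivity) e2).trans ?_
    refine (mul_le_mul e1 e1 (norm_nonneg _) (by positivity)).trans ?_
    have e4 : Real.exp (4 * ν * u) = Real.exp (2 * ν * u) ^ 2 := by
      rw [← Real.exp_nat_mul]; ring_nf
    have e5 : Real.exp (2 * ν * u) = Real.exp (ν * u) ^ 2 := by
      rw [← Real.exp_nat_mul]; ring_nf
    rw [e4]
    nlinarith [sq_nonneg (Real.exp (2 * ν * u) - 2 * lam * Real.exp (ν * u)),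
      sq_nonneg (lam * Real.exp (2 * ν * u)), sq_nonneg (Real.exp (ν * u))]
  · refine Eventually.of_forall fun u y _ => ?_
    refine HasDerivAt.const_mul _ ?_
    set Ψ := logSymbol ν lam (u + rayAngle ν * Complex.I) with hΨ
    have h3 : HasDerivAt (fun y : ℝ => -(y : ℂ) * Ψ) (-1 * Ψ) y :=
      (Complex.ofRealCLM.hasDerivAt.neg).mul_const Ψ
    have h4 := (h3.cexp).const_mul Ψ
    refine h4.congr_deriv ?_
    simp only [densityKernel, ← hΨ]
    ring

/-- Multiplying the kernel by `exp(αw)` multiplies the Laplace transform by `s^α`. The new kernel is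
still admissible because `x > 0`. -/
lemma hasRLDerivAt_inverseDensity (hν0 : 0 < ν) (hν : ν < 1 / 2) (hlam : 0 < lam) {x t α : ℝ}
    (hx : 0 < x) (ht : 0 < t) (hα0 : 0 < α) (hα1 : α < 1) :
    HasRLDerivAt α (fun s => inverseDensity ν lam x s)
      (rayTransform (rayAngle ν) (fun w => Complex.exp (α * w) * densityKernel ν lam x w) t) t := by
  have h₁ := pi_div_two_lt_rayAngle hν0 hν
  have h₂ := rayAngle_lt_pi hν0
  have hν1 : ν ∈ Ioo (0 : ℝ) 1 := ⟨hν0, by linarith⟩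
  have hθ : rayAngle ν ∈ Icc 0 (rayAngle ν) := ⟨by linarith [Real.pi_pos], le_rfl⟩
  obtain ⟨C, hadm⟩ := exists_isRayAdmissible_cexp_mul_densityKernel hν0 hν hlam hx hα0
  set A : ℂ → ℂ := fun w => Complex.exp (α * w) * densityKernel ν lam x w with hA
  have hL := fun s (hs : 0 < s) => (laplace_inverseDensity hν0 hν hlam hs).2 x hx.le
  have hfub := fun s (hs : 0 < s) => laplace_rayTransform_fubini h₁ h₂
    hadm.differentiable.continuous hs (hadm.integrable_norm_div h₁ h₂ hν1 hν1 hs)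
  have b1 := integrable_norm_cexp_mul_densityKernel hν0 hν hlam hx le_rfl
  have b2 : Integrable fun u : ℝ => ‖A (u + rayAngle ν * Complex.I)‖ :=
    integrable_norm_cexp_mul_densityKernel hν0 hν hlam hx hα0.le
  simp only [Complex.ofReal_zero, zero_mul, Complex.exp_zero, one_mul] at b1
  have hjoint := continuousOn_rayTransform (S := univ) (X := Unit) (Φ := fun _ => A) h₁ h₂ hν0 hν0
    (fun _ _ => hadm.differentiable.continuous) (fun _ _ u => hadm.bound u _ hθ)
    (fun u => continuousOn_const)
  have hcont : ContinuousOn (rayTransform (rayAngle ν) A) (Ioi 0) :=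
    hjoint.comp (f := fun s => ((), s)) (by fun_prop) fun s hs => ⟨mem_univ _, hs⟩
  refine hasRLDerivAt_of_laplace hα1
    (continuousOn_inverseDensity_right hν0 hν hlam hx.le)
    (fun s hs => (abs_rayTransform_le h₁ h₂ b1 hs.le).trans (le_max_left _ _))
    hcont (fun s hs => (abs_rayTransform_le h₁ h₂ b2 hs.le).trans (le_max_right _ _))
    (fun s hs => (hL s hs).1) (fun s hs => (hfub s hs).1) (fun s hs => ?_) ht
  rw [(hL s hs).2, hadm.laplace_rayTransform h₁ h₂ hν1 hν1 hs, ← densityKernel_log_re x hs]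
  simp only [hA]
  rw [← Complex.ofReal_mul, ← Complex.ofReal_exp, Complex.re_ofReal_mul,
    mul_comm α, ← Real.rpow_def_of_pos hs]
  ring

/-- The density solves the time-fractional equation. -/
theorem inverseDensity_fractional_equation (hν0 : 0 < ν) (hν : ν < 1 / 2) (hlam : 0 < lam)
    {x t : ℝ} (hx : 0 < x) (ht : 0 < t) : ∃ a b d : ℝ,
      HasRLDerivAt (2 * ν) (fun s => inverseDensity ν lam x s) a t ∧
      HasRLDerivAt ν (fun s => inverseDensity ν lam x s) b t ∧
      HasDerivAt (fun y => inverseDensity ν lam y t) d x ∧ a + 2 * lam * b = -d := by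
  have h₁ := pi_div_two_lt_rayAngle hν0 hν
  have hκ := neg_cos_pos h₁ (rayAngle_lt_pi hν0)
  have hθ : rayAngle ν ∈ Icc 0 (rayAngle ν) := ⟨by linarith [Real.pi_pos], le_rfl⟩
  have hi : ∀ α : ℝ, 0 < α → Integrable fun u : ℝ => Complex.exp
      (t * Complex.exp (u + rayAngle ν * Complex.I))
        * (fun w => Complex.exp (α * w) * densityKernel ν lam x w)
          (u + rayAngle ν * Complex.I) := fun α hα => by
    obtain ⟨C, hadm⟩ := exists_isRayAdmissible_cexp_mul_densityKernel hν0 hν hlam hx hα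
    generalize (fun w => Complex.exp (α * w) * densityKernel ν lam x w) = A at hadm ⊢
    have := hadm.differentiable.continuous
    exact (integrable_exp_add_exp_mul_exp_neg hν0 hν0 (mul_pos ht hκ)).mono' (by fun_prop)
      (Eventually.of_forall fun u => norm_rayIntegrand_le hκ (hadm.bound u _ hθ) le_rfl)
  refine ⟨_, _, _, hasRLDerivAt_inverseDensity hν0 hν hlam hx ht (by linarith) (by linarith),
    hasRLDerivAt_inverseDensity hν0 hν hlam hx ht hν0 (by linarith),
    hasDerivAt_inverseDensity hν0 hν hlam hx ht, ?_⟩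
  have hsum := rayTransform_add_ofReal_mul
    (Φ₁ := fun w => Complex.exp ((2 * ν : ℝ) * w) * densityKernel ν lam x w)
    (Φ₂ := fun w => Complex.exp (ν * w) * densityKernel ν lam x w) (2 * lam)
    (hi _ (by linarith)) (hi ν hν0)
  have hfun : (fun w => Complex.exp ((2 * ν : ℝ) * w) * densityKernel ν lam x w
      + (2 * lam : ℝ) * (Complex.exp (ν * w) * densityKernel ν lam x w))
      = fun w => logSymbol ν lam w * densityKernel ν lam x w := by
    funext w
    simp only [logSymbol]
    push_cast
    ring
  rw [hfun] at hsum
  rw [neg_neg]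
  exact hsum.symm

end Density

/-! ### Mittag-Leffler functions and their Laplace transforms -/

section MittagLeffler

/-- Cut the Gamma integral to `(R, ∞)`, where `t^p ≥ R^p`. -/
lemma rpow_mul_exp_neg_le_Gamma {p R : ℝ} (hp : 0 ≤ p) (hR : 0 ≤ R) :
    R ^ p * Real.exp (-R) ≤ Real.Gamma (p + 1) := by
  have hint := Real.GammaIntegral_convergent (s := p + 1) (by linarith)
  rw [Real.Gamma_eq_integral (by linarith)]
  rw [add_sub_cancel_right] at hint ⊢
  have hsub : Ioi R ⊆ Ioi 0 := Ioi_subset_Ioi hR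
  calc R ^ p * Real.exp (-R) = ∫ t in Ioi R, Real.exp (-t) * R ^ p := by
        rw [integral_mul_const, integral_exp_neg_Ioi, mul_comm]
    _ ≤ ∫ t in Ioi R, Real.exp (-t) * t ^ p := by
        have hexp : IntegrableOn (fun t => Real.exp (-t) * R ^ p) (Ioi R) := by
          have := exp_neg_integrableOn_Ioi R one_pos
          simp only [neg_mul, one_mul] at this
          exact this.mul_const _
        refine setIntegral_mono_on hexp (hint.mono_set hsub) measurableSet_Ioi fun t ht => ?_
        exact mul_le_mul_of_nonneg_left (Real.rpow_le_rpow hR (le_of_lt ht) hp)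
          (Real.exp_pos _).le
    _ ≤ ∫ t in Ioi 0, Real.exp (-t) * t ^ p :=
        setIntegral_mono_set hint ((ae_restrict_mem measurableSet_Ioi).mono fun t ht =>
          mul_nonneg (Real.exp_pos _).le (Real.rpow_nonneg (le_of_lt ht) _)) hsub.eventuallyLE

lemma exists_norm_mittagLeffler_term_le {ν : ℝ} (hν : 0 < ν) {X : ℝ} (hX : 0 ≤ X) :
    ∃ M, ∀ (k : ℕ) (x : ℝ), |x| ≤ X → ‖x ^ k / Real.Gamma (ν * k + 1)‖ ≤ M * (1 / 2) ^ k := by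
  -- With `R^ν = 2X + 1` the Gamma bound reads `1/Γ(νk+1) ≤ exp(R) (2X+1)^(-k)`, and `X/(2X+1) ≤
  -- 1/2`.
  set R : ℝ := (2 * X + 1) ^ (1 / ν) with hR
  have hb : 0 < 2 * X + 1 := by linarith
  refine ⟨Real.exp R, fun k x hx => ?_⟩
  have hνk : 0 ≤ ν * k := by positivity
  have hΓ := rpow_mul_exp_neg_le_Gamma hνk (Real.rpow_nonneg hb.le (1 / ν))
  rw [← hR] at hΓ
  have hRk : R ^ (ν * k) = (2 * X + 1) ^ k := by
    rw [hR, ← Real.rpow_mul hb.le, ← mul_assoc, one_div, inv_mul_cancel₀ hν.ne', one_mul,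
      Real.rpow_natCast]
  rw [hRk] at hΓ
  have hpos : 0 < (2 * X + 1) ^ k * Real.exp (-R) := by positivity
  rw [norm_div, norm_pow, Real.norm_eq_abs, Real.norm_of_nonneg (hpos.le.trans hΓ),
    div_le_iff₀ (hpos.trans_le hΓ)]
  calc |x| ^ k ≤ (1 / 2 * (2 * X + 1)) ^ k := by gcongr; linarith
    _ = Real.exp R * (1 / 2) ^ k * ((2 * X + 1) ^ k * Real.exp (-R)) := by
        rw [mul_pow, Real.exp_neg]
        field_simp
    _ ≤ _ := by gcongr

lemma summable_mittagLeffler {ν : ℝ} (hν : 0 < ν) (x : ℝ) :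
    Summable fun k : ℕ => x ^ k / Real.Gamma (ν * k + 1) := by
  obtain ⟨M, hM⟩ := exists_norm_mittagLeffler_term_le hν (abs_nonneg x)
  exact Summable.of_norm_bounded (summable_geometric_two.mul_left M) fun k => hM k x le_rfl

lemma continuous_mittagLeffler {ν : ℝ} (hν : 0 < ν) : Continuous (mittagLeffler ν 1) := by
  rw [continuous_iff_continuousAt]
  intro x
  obtain ⟨M, hM⟩ := exists_norm_mittagLeffler_term_le hν (by positivity : 0 ≤ |x| + 1)
  have h : ContinuousOn (mittagLeffler ν 1) (Metric.ball x 1) := by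
    refine continuousOn_tsum (fun k => by fun_prop) (summable_geometric_two.mul_left M)
      fun k y hy => hM k y ?_
    rw [Metric.mem_ball, Real.dist_eq] at hy
    have := abs_sub_abs_le_abs_sub y x
    linarith
  exact h.continuousAt (Metric.ball_mem_nhds x one_pos)

lemma laplace_mittagLeffler_term {ν s : ℝ} (hν : 0 < ν) (hs : 0 < s) (r : ℝ) (k : ℕ) :
    IntegrableOn (fun t : ℝ => Real.exp (-s * t) * ((r * t ^ ν) ^ k / Real.Gamma (ν * k + 1)))
      (Ioi 0) ∧
    ∫ t in Ioi (0 : ℝ), Real.exp (-s * t) * ((r * t ^ ν) ^ k / Real.Gamma (ν * k + 1))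
      = s⁻¹ * (r / s ^ ν) ^ k := by
  have hνk : 0 ≤ ν * k := by positivity
  obtain ⟨h1, h2⟩ := laplace_rpow_neg (α := -(ν * k)) (by linarith) hs
  have heq : EqOn (fun t : ℝ => Real.exp (-s * t) * t ^ (-(-(ν * k)))
      * (r ^ k / Real.Gamma (ν * k + 1)))
      (fun t : ℝ => Real.exp (-s * t) * ((r * t ^ ν) ^ k / Real.Gamma (ν * k + 1))) (Ioi 0) := by
    intro t ht
    simp only [neg_neg]
    rw [Real.rpow_mul (le_of_lt ht), Real.rpow_natCast, mul_pow]
    ring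
  refine ⟨IntegrableOn.congr_fun (h1.mul_const _) heq measurableSet_Ioi, ?_⟩
  rw [← setIntegral_congr_fun measurableSet_Ioi heq, integral_mul_const, h2]
  have hΓ : Real.Gamma (ν * k + 1) ≠ 0 := (Real.Gamma_pos_of_pos (by linarith)).ne'
  rw [show 1 - -(ν * k) = ν * k + 1 by ring, show -(ν * (k : ℝ)) - 1 = -(ν * k + 1) by ring,
    Real.rpow_neg hs.le, Real.rpow_add hs, Real.rpow_one, Real.rpow_mul hs.le, Real.rpow_natCast,
    div_pow]
  field_simp

/-- Termwise integration leaves the geometric series in `r / s^ν`. -/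
lemma integral_laplace_mittagLeffler {ν s r : ℝ} (hν : 0 < ν) (hs : 0 < s) (hr : |r| < s ^ ν) :
    ∫ t in Ioi (0 : ℝ), Real.exp (-s * t) * mittagLeffler ν 1 (r * t ^ ν)
      = s ^ (ν - 1) / (s ^ ν - r) := by
  have hsν : 0 < s ^ ν := Real.rpow_pos_of_pos hs ν
  have hsum := hasSum_integral_of_summable_integral_norm
    (μ := volume.restrict (Ioi (0 : ℝ)))
    (F := fun (k : ℕ) (t : ℝ) => Real.exp (-s * t)
      * ((r * t ^ ν) ^ k / Real.Gamma (ν * k + 1)))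
    (fun k => (laplace_mittagLeffler_term hν hs r k).1) ?_
  · simp only [(laplace_mittagLeffler_term hν hs r _).2, tsum_mul_left] at hsum
    have hq : |r / s ^ ν| < 1 := by
      rwa [abs_div, abs_of_pos hsν, div_lt_one hsν]
    have hgeo := (hasSum_geometric_of_abs_lt_one hq).mul_left s⁻¹
    have := hsum.unique hgeo
    unfold mittagLeffler
    rw [this, Real.rpow_sub hs, Real.rpow_one]
    have : s ^ ν - r ≠ 0 := (sub_pos.2 ((le_abs_self r).trans_lt hr)).ne'
    field_simp
  · have hn : ∀ k : ℕ, ∫ t in Ioi (0 : ℝ), ‖Real.exp (-s * t)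
        * ((r * t ^ ν) ^ k / Real.Gamma (ν * k + 1))‖ = s⁻¹ * (|r| / s ^ ν) ^ k := fun k => by
      rw [← (laplace_mittagLeffler_term hν hs |r| k).2]
      refine setIntegral_congr_fun measurableSet_Ioi fun t ht => ?_
      have hΓ : 0 < Real.Gamma (ν * k + 1) := Real.Gamma_pos_of_pos (by positivity)
      have ht' : 0 ≤ t ^ ν := Real.rpow_nonneg (le_of_lt ht) ν
      simp only [norm_mul, norm_div, norm_pow, Real.norm_eq_abs, Real.abs_exp, abs_of_pos hΓ,
        abs_of_nonneg ht']
    simp only [hn]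
    refine (summable_geometric_of_lt_one (by positivity) ?_).mul_left _
    rwa [div_lt_one hsν]

lemma abs_mittagLeffler_le {ν : ℝ} (hν : 0 < ν) (x : ℝ) :
    |mittagLeffler ν 1 x| ≤ mittagLeffler ν 1 |x| := by
  rw [← Real.norm_eq_abs]
  refine tsum_of_norm_bounded (summable_mittagLeffler hν |x|).hasSum fun k => ?_
  have hΓ : 0 < Real.Gamma (ν * k + 1) := Real.Gamma_pos_of_pos (by positivity)
  rw [norm_div, norm_pow, Real.norm_eq_abs, Real.norm_of_nonneg hΓ.le]

lemma integrableOn_laplace_mittagLeffler {ν s r : ℝ} (hν : 0 < ν) (hs : 0 < s)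
    (hr : |r| < s ^ ν) :
    IntegrableOn (fun t : ℝ => Real.exp (-s * t) * mittagLeffler ν 1 (r * t ^ ν)) (Ioi 0) := by
  have hsν : 0 < s ^ ν := Real.rpow_pos_of_pos hs ν
  have habs : IntegrableOn (fun t : ℝ => Real.exp (-s * t) * mittagLeffler ν 1 (|r| * t ^ ν))
      (Ioi 0) := by
    -- The integral of a non-integrable function is `0` by convention, and this one is positive.
    refine not_imp_comm.1 integral_undef ?_
    rw [integral_laplace_mittagLeffler hν hs (by rwa [abs_abs])]
    exact (div_pos (Real.rpow_pos_of_pos hs _) (sub_pos.2 hr)).ne'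
  have hm := (continuous_mittagLeffler hν).measurable
  refine Integrable.mono' habs (Measurable.aestronglyMeasurable (by fun_prop)) ?_
  filter_upwards [ae_restrict_mem measurableSet_Ioi] with t ht
  have ht' : 0 ≤ t ^ ν := Real.rpow_nonneg (le_of_lt ht) ν
  rw [norm_mul, Real.norm_of_nonneg (Real.exp_pos _).le]
  refine mul_le_mul_of_nonneg_left ?_ (Real.exp_pos _).le
  have := abs_mittagLeffler_le hν (r * t ^ ν)
  rwa [abs_mul, abs_of_nonneg ht'] at this

/-- The right-hand side of the `x`-Laplace transform formula. -/
noncomputable def mittagLefflerMixture (ν lam γ t : ℝ) : ℝ :=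
  1 / 2 * ((1 + lam / √(lam ^ 2 - γ)) * mittagLeffler ν 1 ((-lam + √(lam ^ 2 - γ)) * t ^ ν)
    + (1 - lam / √(lam ^ 2 - γ)) * mittagLeffler ν 1 ((-lam - √(lam ^ 2 - γ)) * t ^ ν))

lemma continuousOn_mittagLefflerMixture {ν : ℝ} (hν : 0 < ν) (lam γ : ℝ) :
    ContinuousOn (mittagLefflerMixture ν lam γ) (Ioi 0) := by
  have hc := continuous_mittagLeffler hν
  have hp : ContinuousOn (fun t : ℝ => t ^ ν) (Ioi 0) := fun t ht =>
    (Real.continuousAt_rpow_const _ _ (Or.inl (ne_of_gt ht))).continuousWithinAt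
  unfold mittagLefflerMixture
  fun_prop

/-- Partial fractions in `X = s^ν`: the roots of `X² + 2λX + γ` are `-λ ± √(λ²-γ)`. -/
lemma laplace_mittagLefflerMixture {ν lam γ s : ℝ} (hν : 0 < ν) (hγ : γ < lam ^ 2) (hs : 0 < s)
    (hlam : 0 < lam) (hbig : lam + √(lam ^ 2 - γ) < s ^ ν) :
    IntegrableOn (fun t => Real.exp (-s * t) * mittagLefflerMixture ν lam γ t) (Ioi 0) ∧
    ∫ t in Ioi (0 : ℝ), Real.exp (-s * t) * mittagLefflerMixture ν lam γ t
      = (s ^ (2 * ν) + 2 * lam * s ^ ν) / (s * (s ^ (2 * ν) + 2 * lam * s ^ ν + γ)) := by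
  set D := √(lam ^ 2 - γ) with hD
  have hD0 : 0 < D := Real.sqrt_pos.2 (by linarith)
  have hD2 : D ^ 2 = lam ^ 2 - γ := Real.sq_sqrt (by linarith)
  have hr1 : |-lam + D| < s ^ ν := by rw [abs_lt]; constructor <;> linarith
  have hr2 : |-lam - D| < s ^ ν := by rw [abs_lt]; constructor <;> linarith
  have i1 := (integrableOn_laplace_mittagLeffler hν hs hr1).const_mul (1 / 2 * (1 + lam / D))
  have i2 := (integrableOn_laplace_mittagLeffler hν hs hr2).const_mul (1 / 2 * (1 - lam / D))
  have heq : (fun t => Real.exp (-s * t) * mittagLefflerMixture ν lam γ t)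
      = fun t => 1 / 2 * (1 + lam / D) * (Real.exp (-s * t)
        * mittagLeffler ν 1 ((-lam + D) * t ^ ν)) + 1 / 2 * (1 - lam / D) * (Real.exp (-s * t)
        * mittagLeffler ν 1 ((-lam - D) * t ^ ν)) := by
    funext t
    simp only [mittagLefflerMixture, ← hD]
    ring
  rw [heq]
  refine ⟨i1.add i2, ?_⟩
  rw [integral_add i1 i2, integral_const_mul, integral_const_mul,
    integral_laplace_mittagLeffler hν hs hr1, integral_laplace_mittagLeffler hν hs hr2,
    Real.rpow_sub hs, Real.rpow_one, show 2 * ν = ν + ν by ring, Real.rpow_add hs]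
  have h1 : s ^ ν - (-lam + D) ≠ 0 := (by linarith [(abs_lt.1 hr1).2] : 0 < s ^ ν - (-lam + D)).ne'
  have h2 : s ^ ν - (-lam - D) ≠ 0 := (by linarith [(abs_lt.1 hr2).2] : 0 < s ^ ν - (-lam - D)).ne'
  have h3 : s ^ ν * s ^ ν + 2 * lam * s ^ ν + γ = (s ^ ν - (-lam + D)) * (s ^ ν - (-lam - D)) := by
    linear_combination hD2
  rw [h3]
  field_simp
  ring

end MittagLeffler

/-! ### Increasing processes and their inverses -/

/-- A nondecreasing right-continuous process started at `0` with Laplace transforms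
`𝔼 exp (-s H(x)) = exp (-x Ψ(s))`. -/
structure IsIncreasingWithExponent {Ω : Type*} [MeasurableSpace Ω] (Ψ : ℝ → ℝ)
    (H : ℝ≥0 → Ω → ℝ) (P : Measure Ω) : Prop where
  measurable : ∀ x, Measurable (H x)
  paths : ∀ᵐ ω ∂P, H 0 ω = 0 ∧ (Monotone fun x => H x ω) ∧
    ∀ x, ContinuousWithinAt (fun y => H y ω) (Ici x) x
  laplace : ∀ (x : ℝ≥0) (s : ℝ), 0 < s →
    ∫ ω, Real.exp (-s * H x ω) ∂P = Real.exp (-(x : ℝ) * Ψ s)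

section InversePath

variable {Ω : Type*} {H : ℝ≥0 → Ω → ℝ} {ω : Ω} {t : ℝ}

lemma inverseProcess_le_iff (h0 : H 0 ω = 0) (hm : Monotone fun x => H x ω)
    (hr : ∀ x, ContinuousWithinAt (fun y => H y ω) (Ici x) x) (hu : ∃ x, t ≤ H x ω) (ht : 0 < t)
    (x : ℝ≥0) : inverseProcess H t ω ≤ x ↔ t ≤ H x ω := by
  -- The constraint `0 < s` is redundant, because `H` starts at `0 < t`.
  have hset : {s : ℝ≥0 | 0 < s ∧ t ≤ H s ω} = {s : ℝ≥0 | t ≤ H s ω} := by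
    ext s
    simp only [mem_ofPred_eq, and_iff_right_iff_imp]
    intro hs
    rcases eq_or_ne s 0 with rfl | hne
    · rw [h0] at hs
      exact absurd hs (not_le.2 ht)
    · exact pos_iff_ne_zero.2 hne
  rw [inverseProcess, hset, NNReal.coe_le_coe]
  constructor
  -- Every `y > x` satisfies `t ≤ H y`; right-continuity passes this to `x`.
  · intro hle
    have hgt : ∀ y, x < y → t ≤ H y ω := fun y hy => by
      obtain ⟨z, hz, hzy⟩ := exists_lt_of_csInf_lt hu (hle.trans_lt hy)
      exact le_trans hz (hm hzy.le)
    have hlim : Tendsto (fun y => H y ω) (𝓝[>] x) (𝓝 (H x ω)) :=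
      (hr x).tendsto.mono_left (nhdsWithin_mono _ Ioi_subset_Ici_self)
    exact ge_of_tendsto hlim (eventually_nhdsWithin_of_forall hgt)
  · intro hle
    exact csInf_le (OrderBot.bddBelow _) hle

lemma inverseProcess_nonneg : 0 ≤ inverseProcess H t ω := NNReal.coe_nonneg _

end InversePath

namespace IsIncreasingWithExponent

variable {Ω : Type*} [MeasurableSpace Ω] {P : Measure Ω} {Ψ : ℝ → ℝ} {H : ℝ≥0 → Ω → ℝ}

lemma integrable_exp (hH : IsIncreasingWithExponent Ψ H P) (x : ℝ≥0) {s : ℝ} (hs : 0 < s) :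
    Integrable (fun ω => Real.exp (-s * H x ω)) P := by
  refine not_imp_comm.1 integral_undef ?_
  rw [hH.laplace x s hs]
  exact (Real.exp_pos _).ne'

lemma ae_nonneg (hH : IsIncreasingWithExponent Ψ H P) (x : ℝ≥0) : ∀ᵐ ω ∂P, 0 ≤ H x ω := by
  filter_upwards [hH.paths] with ω hω
  rw [← hω.1]
  exact hω.2.1 (zero_le)

variable [IsProbabilityMeasure P]

/-- Chernoff bound for the process. -/
lemma measureReal_le_le (hH : IsIncreasingWithExponent Ψ H P) (x : ℝ≥0) {s : ℝ} (hs : 0 < s)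
    (t : ℝ) : P.real {ω | H x ω ≤ t} ≤ Real.exp (s * t - x * Ψ s) := by
  have h := measure_le_le_exp_mul_mgf (X := H x) (μ := P) t (neg_nonpos.2 hs.le)
    (hH.integrable_exp x hs)
  rw [mgf, hH.laplace x s hs, ← Real.exp_add] at h
  convert h using 2
  ring

/-- By Chernoff at `s = 1`, `P(H(n) ≤ N) ≤ exp(N - nΨ(1)) → 0`. Almost surely the infimum is
therefore over a nonempty set, and the default `sInf ∅ = 0` does not occur. -/
lemma ae_unbounded (hH : IsIncreasingWithExponent Ψ H P) (hΨ : 0 < Ψ 1) :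
    ∀ᵐ ω ∂P, ∀ t : ℝ, ∃ x, t ≤ H x ω := by
  have hN : ∀ N : ℕ, ∀ᵐ ω ∂P, ∃ x, (N : ℝ) ≤ H x ω := fun N => by
    rw [ae_iff]
    have hle : ∀ n : ℕ, P.real {ω | ¬∃ x, (N : ℝ) ≤ H x ω}
        ≤ Real.exp (1 * N - (n : ℝ≥0) * Ψ 1) := fun n => by
      refine le_trans (measureReal_mono fun ω hω => ?_) (hH.measureReal_le_le n one_pos N)
      simp only [mem_ofPred_eq, not_exists, not_le] at hω ⊢
      exact (hω n).le
    have hlim : Tendsto (fun n : ℕ => Real.exp (1 * N - ((n : ℝ≥0) : ℝ) * Ψ 1)) atTop (𝓝 0) := by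
      refine Real.tendsto_exp_atBot.comp ?_
      simp only [NNReal.coe_natCast, sub_eq_add_neg]
      refine tendsto_atBot_add_const_left _ _ (tendsto_neg_atTop_atBot.comp ?_)
      exact tendsto_natCast_atTop_atTop.atTop_mul_const hΨ
    have h0 : P.real {ω | ¬∃ x, (N : ℝ) ≤ H x ω} ≤ 0 := ge_of_tendsto' hlim hle
    exact (measureReal_eq_zero_iff).1 (le_antisymm h0 measureReal_nonneg)
  filter_upwards [ae_all_iff.2 hN] with ω hω t
  obtain ⟨N, hNt⟩ := exists_nat_ge t
  obtain ⟨x, hx⟩ := hω N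
  exact ⟨x, hNt.trans hx⟩

lemma ae_inverseProcess_le_iff (hH : IsIncreasingWithExponent Ψ H P) (hΨ : 0 < Ψ 1) :
    ∀ᵐ ω ∂P, ∀ t : ℝ, 0 < t → ∀ x : ℝ≥0, inverseProcess H t ω ≤ x ↔ t ≤ H x ω := by
  filter_upwards [hH.paths, hH.ae_unbounded hΨ] with ω hω hu t ht x
  exact inverseProcess_le_iff hω.1 hω.2.1 hω.2.2 (hu t) ht x

lemma aemeasurable_inverseProcess (hH : IsIncreasingWithExponent Ψ H P) (hΨ : 0 < Ψ 1) {t : ℝ}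
    (ht : 0 < t) : AEMeasurable (inverseProcess H t) P := by
  obtain ⟨N, hsub, hNm, hN0⟩ := exists_measurable_superset_of_null
    (ae_iff.1 (hH.ae_inverseProcess_le_iff hΨ))
  have hgood : ∀ ω ∉ N, ∀ x : ℝ≥0, inverseProcess H t ω ≤ x ↔ t ≤ H x ω := fun ω hω x => by
    by_contra hne
    exact hω (hsub fun hall => hne (hall t ht x))
  refine ⟨Nᶜ.indicator (inverseProcess H t), measurable_of_Iic fun x => ?_, ?_⟩
  · rcases lt_or_ge x 0 with hx | hx
    · convert! MeasurableSet.empty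
      ext ω
      simp only [mem_preimage, mem_Iic, mem_empty_iff_false, iff_false, not_le]
      exact hx.trans_le (indicator_nonneg (fun ω _ => inverseProcess_nonneg) ω)
    · have : Nᶜ.indicator (inverseProcess H t) ⁻¹' Iic x
          = N ∪ (Nᶜ ∩ {ω | t ≤ H x.toNNReal ω}) := by
        ext ω
        by_cases hω : ω ∈ N
        · simp [hω, hx]
        · have := hgood ω hω x.toNNReal
          rw [Real.coe_toNNReal x hx] at this
          simp [hω, this]
      rw [this]
      exact hNm.union (hNm.compl.inter (measurableSet_le measurable_const (hH.measurable _)))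
  · have : ∀ᵐ ω ∂P, ω ∉ N := measure_eq_zero_iff_ae_notMem.1 hN0
    filter_upwards [this] with ω hω
    rw [indicator_of_mem (by exact hω)]

lemma measure_inverseProcess_le (hH : IsIncreasingWithExponent Ψ H P) (hΨ : 0 < Ψ 1) {t : ℝ}
    (ht : 0 < t) (x : ℝ≥0) :
    P {ω | inverseProcess H t ω ≤ x} = P {ω | t ≤ H x ω} := by
  refine measure_congr ?_
  filter_upwards [hH.ae_inverseProcess_le_iff hΨ] with ω hω
  exact propext (hω t ht x)

lemma ae_monotone_inverseProcess (hH : IsIncreasingWithExponent Ψ H P) (hΨ : 0 < Ψ 1) :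
    ∀ᵐ ω ∂P, MonotoneOn (fun t => inverseProcess H t ω) (Ioi 0) := by
  filter_upwards [hH.ae_inverseProcess_le_iff hΨ] with ω hω t ht t' ht' htt'
  have hle := (hω t ht _).2 (htt'.trans ((hω t' ht' (inverseProcess H t' ω).toNNReal).1
    (Real.le_coe_toNNReal _)))
  rwa [Real.coe_toNNReal _ inverseProcess_nonneg] at hle

/-- Laplace transform in `t` of the tail `P(H(x) ≥ t)`. -/
lemma laplace_tail (hH : IsIncreasingWithExponent Ψ H P) (x : ℝ≥0) {s : ℝ} (hs : 0 < s) :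
    IntegrableOn (fun t => Real.exp (-s * t) * P.real {ω | t ≤ H x ω}) (Ioi 0) ∧
    ∫ t in Ioi (0 : ℝ), Real.exp (-s * t) * P.real {ω | t ≤ H x ω}
      = (1 - Real.exp (-(x : ℝ) * Ψ s)) / s := by
  set A : Set (ℝ × Ω) := {p | p.1 ≤ H x p.2} with hA
  have hAm : MeasurableSet A :=
    measurableSet_le measurable_fst ((hH.measurable x).comp measurable_snd)
  set f : ℝ × Ω → ℝ := A.indicator fun p => Real.exp (-s * p.1) with hf
  have hexp : IntegrableOn (fun t : ℝ => Real.exp (-s * t)) (Ioi 0) :=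
    exp_neg_integrableOn_Ioi 0 hs
  have hfi : Integrable f ((volume.restrict (Ioi (0 : ℝ))).prod P) :=
    (hexp.comp_fst P).indicator hAm
  have hinner : ∀ t : ℝ, ∫ ω, f (t, ω) ∂P = Real.exp (-s * t) * P.real {ω | t ≤ H x ω} := by
    intro t
    have hm : MeasurableSet {ω | t ≤ H x ω} := measurableSet_le measurable_const (hH.measurable x)
    have : (fun ω => f (t, ω)) = {ω | t ≤ H x ω}.indicator fun _ => Real.exp (-s * t) := by
      funext ω
      simp [hf, hA, indicator]
    rw [this, integral_indicator_const _ hm, smul_eq_mul, mul_comm]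
  have houter : ∀ᵐ ω ∂P, ∫ t in Ioi (0 : ℝ), f (t, ω) = (1 - Real.exp (-s * H x ω)) / s := by
    filter_upwards [hH.ae_nonneg x] with ω hω
    have : (fun t => f (t, ω)) = (Iic (H x ω)).indicator fun t => Real.exp (-s * t) := by
      funext t
      simp [hf, hA, indicator]
    rw [this, setIntegral_indicator measurableSet_Iic, Ioi_inter_Iic,
      ← intervalIntegral.integral_of_le hω]
    have hd : ∀ t ∈ uIcc 0 (H x ω), HasDerivAt (fun t => -Real.exp (-s * t) / s)
        (Real.exp (-s * t)) t := fun t _ => by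
      have h1 : HasDerivAt (fun t : ℝ => -s * t) (-s) t := by
        simpa using (hasDerivAt_id t).const_mul (-s)
      refine ((h1.exp.neg).div_const s).congr_deriv ?_
      field_simp
    rw [intervalIntegral.integral_eq_sub_of_hasDerivAt hd
      (Continuous.intervalIntegrable (by fun_prop) _ _)]
    simp
    ring
  simp only [← hinner]
  refine ⟨hfi.integral_prod_left, ?_⟩
  rw [integral_integral_swap (f := fun t ω => f (t, ω)) hfi, integral_congr_ae houter, integral_div,
    integral_sub (integrable_const _) (hH.integrable_exp x hs), hH.laplace x s hs]
  simp

end IsIncreasingWithExponent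

lemma IsStableSubordinator.integrable_exp {Ω : Type*} [MeasurableSpace Ω] {α : ℝ}
    {H : ℝ≥0 → Ω → ℝ} {P : Measure Ω} (hH : IsStableSubordinator α H P) (x : ℝ≥0) {s : ℝ}
    (hs : 0 < s) : Integrable (fun ω => Real.exp (-s * H x ω)) P := by
  refine not_imp_comm.1 integral_undef ?_
  rw [hH.laplace x s hs]
  exact (Real.exp_pos _).ne'

/-- Independence multiplies the transforms, and the scale `(2λ)^(1/ν)` is the one whose `ν`-th power
is `2λ`. -/
lemma isIncreasingWithExponent_sumProcess {Ω : Type*} [MeasurableSpace Ω] {P : Measure Ω}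
    {ν lam : ℝ} (hν0 : 0 < ν) (hlam : 0 < lam) {H₁ H₂ : ℝ≥0 → Ω → ℝ}
    (hH₁ : IsStableSubordinator (2 * ν) H₁ P) (hH₂ : IsStableSubordinator ν H₂ P)
    (hindep : IndepFun (fun ω t => H₁ t ω) (fun ω t => H₂ t ω) P) :
    IsIncreasingWithExponent (fun s => s ^ (2 * ν) + 2 * lam * s ^ ν)
      (sumProcess ν lam H₁ H₂) P where
  measurable x := (hH₁.measurable x).add ((hH₂.measurable x).const_mul _)
  paths := by
    have hc : 0 ≤ (2 * lam) ^ (1 / ν) := Real.rpow_nonneg (by linarith) _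
    filter_upwards [hH₁.paths, hH₂.paths] with ω h1 h2
    refine ⟨by simp [sumProcess, h1.1, h2.1], fun x y hxy => ?_, fun x => ?_⟩
    · exact add_le_add (h1.2.1 hxy) (mul_le_mul_of_nonneg_left (h2.2.1 hxy) hc)
    · exact (h1.2.2 x).add (continuousWithinAt_const.mul (h2.2.2 x))
  laplace x s hs := by
    have hc : 0 < (2 * lam) ^ (1 / ν) := Real.rpow_pos_of_pos (by linarith) _
    have hind : IndepFun (fun ω => Real.exp (-s * H₁ x ω))
        (fun ω => Real.exp (-(s * (2 * lam) ^ (1 / ν)) * H₂ x ω)) P :=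
      hindep.comp (φ := fun h : ℝ≥0 → ℝ => Real.exp (-s * h x))
        (ψ := fun h : ℝ≥0 → ℝ => Real.exp (-(s * (2 * lam) ^ (1 / ν)) * h x))
        (by fun_prop) (by fun_prop)
    have hprod : ∀ ω, Real.exp (-s * sumProcess ν lam H₁ H₂ x ω)
        = Real.exp (-s * H₁ x ω) * Real.exp (-(s * (2 * lam) ^ (1 / ν)) * H₂ x ω) := fun ω => by
      rw [← Real.exp_add, sumProcess]
      ring_nf
    simp only [hprod]
    rw [hind.integral_fun_mul_eq_mul_integral (hH₁.integrable_exp x hs).1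
      (hH₂.integrable_exp x (mul_pos hs hc)).1, hH₁.laplace x s hs,
      hH₂.laplace x _ (mul_pos hs hc), ← Real.exp_add, Real.mul_rpow hs.le hc.le,
      ← Real.rpow_mul (by linarith), one_div, inv_mul_cancel₀ hν0.ne', Real.rpow_one]
    ring_nf

/-! ### The primitive of the density in space -/

section Primitive

variable {ν lam : ℝ}

lemma continuousOn_integral_inverseDensity (hν0 : 0 < ν) (hν : ν < 1 / 2) (hlam : 0 < lam) {x : ℝ}
    (hx : 0 ≤ x) :
    ContinuousOn (fun t => ∫ y in (0 : ℝ)..x, inverseDensity ν lam y t) (Ioi 0) := by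
  intro t ht
  have ht' : 0 < t := ht
  have hcompact : IsCompact (Icc 0 x ×ˢ Icc (t / 2) (2 * t)) := isCompact_Icc.prod isCompact_Icc
  have hsub : Icc 0 x ×ˢ Icc (t / 2) (2 * t) ⊆ Ici (0 : ℝ) ×ˢ Ioi (0 : ℝ) := fun p hp =>
    ⟨hp.1.1, lt_of_lt_of_le (by positivity) hp.2.1⟩
  obtain ⟨K, hK⟩ := hcompact.exists_bound_of_continuousOn
    ((continuousOn_inverseDensity hν0 hν hlam).mono hsub)
  refine intervalIntegral.continuousWithinAt_of_dominated_interval (bound := fun _ => K) ?_ ?_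
    (by simp) ?_
  · filter_upwards [self_mem_nhdsWithin] with τ hτ
    rw [uIoc_of_le hx]
    exact ((continuousOn_inverseDensity_left hν0 hν hlam hτ).mono
      fun y hy => hy.1.le).aestronglyMeasurable measurableSet_Ioc
  · have : ∀ᶠ τ in 𝓝 t, τ ∈ Icc (t / 2) (2 * t) := Icc_mem_nhds (by linarith) (by linarith)
    filter_upwards [nhdsWithin_le_nhds this] with τ hτ
    refine Eventually.of_forall fun y hy => ?_
    rw [uIoc_of_le hx] at hy
    exact hK (y, τ) ⟨⟨hy.1.le, hy.2⟩, hτ⟩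
  · refine Eventually.of_forall fun y hy => ?_
    rw [uIoc_of_le hx] at hy
    exact (continuousOn_inverseDensity_right hν0 hν hlam hy.1.le) t ht

lemma aestronglyMeasurable_inverseDensity (hν0 : 0 < ν) (hν : ν < 1 / 2) (hlam : 0 < lam)
    {S : Set ℝ} (hS : MeasurableSet S) (hS0 : S ⊆ Ici 0) :
    AEStronglyMeasurable (fun p : ℝ × ℝ => inverseDensity ν lam p.1 p.2)
      ((volume.restrict S).prod (volume.restrict (Ioi (0 : ℝ)))) := by
  rw [Measure.prod_restrict]
  exact ((continuousOn_inverseDensity hν0 hν hlam).mono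
    (prod_mono hS0 subset_rfl)).aestronglyMeasurable (hS.prod measurableSet_Ioi)

/-- The `L¹` bound uniform in `y` permits Fubini, leaving `∫₀ˣ Ψ exp(-yΨ) dy / s`. -/
lemma laplace_integral_inverseDensity (hν0 : 0 < ν) (hν : ν < 1 / 2) (hlam : 0 < lam) {x s : ℝ}
    (hx : 0 ≤ x) (hs : 0 < s) :
    IntegrableOn (fun t => Real.exp (-s * t) * ∫ y in (0 : ℝ)..x, inverseDensity ν lam y t)
      (Ioi 0) ∧
    ∫ t in Ioi (0 : ℝ), Real.exp (-s * t) * ∫ y in (0 : ℝ)..x, inverseDensity ν lam y t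
      = (1 - Real.exp (-x * (s ^ (2 * ν) + 2 * lam * s ^ ν))) / s := by
  obtain ⟨⟨B, hB⟩, hL⟩ := laplace_inverseDensity hν0 hν hlam hs
  set Ψ := s ^ (2 * ν) + 2 * lam * s ^ ν with hΨ
  have hf : Integrable (fun p : ℝ × ℝ => Real.exp (-s * p.2) * inverseDensity ν lam p.1 p.2)
      ((volume.restrict (Ioc 0 x)).prod (volume.restrict (Ioi (0 : ℝ)))) := by
    have hm : AEStronglyMeasurable
        (fun p : ℝ × ℝ => Real.exp (-s * p.2) * inverseDensity ν lam p.1 p.2)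
        ((volume.restrict (Ioc 0 x)).prod (volume.restrict (Ioi (0 : ℝ)))) :=
      (Continuous.aestronglyMeasurable (by fun_prop)).mul
        (aestronglyMeasurable_inverseDensity hν0 hν hlam measurableSet_Ioc fun y hy => hy.1.le)
    rw [integrable_prod_iff hm]
    refine ⟨?_, ?_⟩
    · filter_upwards [ae_restrict_mem measurableSet_Ioc] with y hy
      exact (hL y hy.1.le).1
    · refine Integrable.mono' (integrable_const B) hm.norm.integral_prod_right' ?_
      filter_upwards [ae_restrict_mem measurableSet_Ioc] with y hy
      rw [Real.norm_of_nonneg (integral_nonneg fun _ => norm_nonneg _)]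
      exact hB y hy.1.le
  have hfun : ∀ t : ℝ, Real.exp (-s * t) * ∫ y in (0 : ℝ)..x, inverseDensity ν lam y t
      = ∫ y in Ioc 0 x, Real.exp (-s * t) * inverseDensity ν lam y t := fun t => by
    rw [integral_const_mul, intervalIntegral.integral_of_le hx]
  simp only [hfun]
  refine ⟨hf.integral_prod_right, ?_⟩
  rw [← integral_integral_swap (f := fun y t => Real.exp (-s * t) * inverseDensity ν lam y t) hf,
    setIntegral_congr_fun measurableSet_Ioc fun y hy => (hL y hy.1.le).2,
    ← intervalIntegral.integral_of_le hx]
  have hd : ∀ y ∈ uIcc 0 x, HasDerivAt (fun y => -Real.exp (-y * Ψ) / s)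
      (Ψ * Real.exp (-y * Ψ) / s) y := fun y _ => by
    have h1 : HasDerivAt (fun y : ℝ => -y * Ψ) (-1 * Ψ) y :=
      ((hasDerivAt_id y).neg).mul_const Ψ
    refine ((h1.exp.neg).div_const s).congr_deriv ?_
    ring
  rw [intervalIntegral.integral_eq_sub_of_hasDerivAt hd
    (Continuous.intervalIntegrable (by fun_prop) _ _)]
  simp
  ring

end Primitive

lemma exponent_pos {ν lam : ℝ} (hlam : 0 < lam) {s : ℝ} (hs : 0 < s) :
    0 < s ^ (2 * ν) + 2 * lam * s ^ ν := by positivity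

/-- Change of variables for a real random variable with a continuous density. -/
lemma HasContinuousDensity.integral_comp {Ω : Type*} [MeasurableSpace Ω]
    {P : Measure Ω} {X : Ω → ℝ} {f g : ℝ → ℝ}
    (hX : HasContinuousDensity X f P) (hg : Measurable g) :
    (Integrable (fun ω => g (X ω)) P ↔ IntegrableOn (fun x => g x * f x) (Ioi 0)) ∧
    ∫ ω, g (X ω) ∂P = ∫ x in Ioi (0 : ℝ), g x * f x := by
  obtain ⟨hc, hnn, hlaw⟩ := hX
  have hfm : AEMeasurable (fun x => ENNReal.ofReal (f x)) (volume.restrict (Ici (0 : ℝ))) :=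
    (hc.aemeasurable measurableSet_Ici).ennreal_ofReal
  have hlt : ∀ᵐ x ∂(volume.restrict (Ici (0 : ℝ))), ENNReal.ofReal (f x) < ∞ :=
    Eventually.of_forall fun x => ENNReal.ofReal_lt_top
  have heq : (fun x => (ENNReal.ofReal (f x)).toReal • g x)
      =ᵐ[volume.restrict (Ici (0 : ℝ))] fun x => g x * f x := by
    filter_upwards [ae_restrict_mem measurableSet_Ici] with x hx
    rw [ENNReal.toReal_ofReal (hnn x hx), smul_eq_mul, mul_comm]
  have hrestr : volume.restrict (Ioi (0 : ℝ)) = volume.restrict (Ici 0) :=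
    Measure.restrict_congr_set Ioi_ae_eq_Ici
  constructor
  · change Integrable (g ∘ X) P ↔ _
    rw [← integrable_map_measure hg.aestronglyMeasurable hlaw.aemeasurable, hlaw.map_eq,
      integrable_withDensity_iff_integrable_smul₀' hfm hlt, integrable_congr heq, IntegrableOn,
      hrestr]
  · rw [← integral_map hlaw.aemeasurable hg.aestronglyMeasurable, hlaw.map_eq,
      integral_withDensity_eq_integral_toReal_smul₀ hfm hlt, integral_congr_ae heq, hrestr]

/-! ### The law of the inverse process -/

section Law

variable {Ω : Type*} [MeasurableSpace Ω] {P : Measure Ω} [IsProbabilityMeasure P] {ν lam : ℝ}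
  {H : ℝ≥0 → Ω → ℝ}

/-- Both sides have Laplace transform `(1 - exp(-xΨ))/s` in `t`; the tail is antitone and the
primitive continuous, so they agree at every `t`. -/
lemma integral_inverseDensity_eq (hν0 : 0 < ν) (hν : ν < 1 / 2) (hlam : 0 < lam)
    (hH : IsIncreasingWithExponent (fun s => s ^ (2 * ν) + 2 * lam * s ^ ν) H P) (x : ℝ≥0) {t : ℝ}
    (ht : 0 < t) :
    ∫ y in (0 : ℝ)..x, inverseDensity ν lam y t = P.real {ω | t ≤ H x ω} := by
  have hae := ae_eq_of_laplace_eq (s₀ := 0) (f := fun t => P.real {ω | t ≤ H x ω})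
    (g := fun t => ∫ y in (0 : ℝ)..x, inverseDensity ν lam y t)
    (fun s hs => (hH.laplace_tail x hs).1)
    (fun s hs => (laplace_integral_inverseDensity hν0 hν hlam x.coe_nonneg hs).1)
    (fun s hs => by
      rw [(hH.laplace_tail x hs).2,
        (laplace_integral_inverseDensity hν0 hν hlam x.coe_nonneg hs).2])
  have hanti : AntitoneOn (fun t => P.real {ω | t ≤ H x ω}) (Ioi 0) := fun t _ t' _ htt' =>
    measureReal_mono fun ω hω => le_trans htt' hω
  exact (hanti.eqOn_of_ae_eq_continuousOn
    (continuousOn_integral_inverseDensity hν0 hν hlam x.coe_nonneg) hae ht).symm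

/-- For `x > 0` the density is the derivative of `x ↦ P(t ≤ H(x))`, nondecreasing since the paths
are. The point `x = 0` follows by continuity. -/
lemma inverseDensity_nonneg (hν0 : 0 < ν) (hν : ν < 1 / 2) (hlam : 0 < lam)
    (hH : IsIncreasingWithExponent (fun s => s ^ (2 * ν) + 2 * lam * s ^ ν) H P) {x t : ℝ}
    (hx : 0 ≤ x) (ht : 0 < t) : 0 ≤ inverseDensity ν lam x t := by
  have hcont := continuousOn_inverseDensity_left hν0 hν hlam ht
  have hmono : MonotoneOn (fun x => ∫ y in (0 : ℝ)..x, inverseDensity ν lam y t) (Ioi 0) := by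
    intro a ha b hb hab
    have ea := integral_inverseDensity_eq hν0 hν hlam hH a.toNNReal ht
    have eb := integral_inverseDensity_eq hν0 hν hlam hH b.toNNReal ht
    rw [Real.coe_toNNReal a (le_of_lt ha)] at ea
    rw [Real.coe_toNNReal b (le_of_lt hb)] at eb
    simp only
    rw [ea, eb]
    refine ENNReal.toReal_mono (measure_ne_top _ _) (measure_mono_ae ?_)
    filter_upwards [hH.paths] with ω hω hle
    exact le_trans hle (hω.2.1 (Real.toNNReal_le_toNNReal hab))
  have hpos : ∀ y ∈ Ioi (0 : ℝ), 0 ≤ inverseDensity ν lam y t := by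
    intro y hy
    have hy' : 0 < y := hy
    have hint : IntervalIntegrable (fun z => inverseDensity ν lam z t) volume 0 y := by
      refine ContinuousOn.intervalIntegrable (hcont.mono fun z hz => ?_)
      rw [uIcc_of_le hy'.le] at hz
      exact hz.1
    have hopen : ContinuousOn (fun z => inverseDensity ν lam z t) (Ioi 0) :=
      hcont.mono Ioi_subset_Ici_self
    have hd : HasDerivAt (fun x => ∫ z in (0 : ℝ)..x, inverseDensity ν lam z t)
        (inverseDensity ν lam y t) y :=
      intervalIntegral.integral_hasDerivAt_right hint
        (hopen.stronglyMeasurableAtFilter isOpen_Ioi y hy)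
        (hopen.continuousAt (Ioi_mem_nhds hy'))
    rw [← hd.hasDerivWithinAt.derivWithin (isOpen_Ioi.uniqueDiffWithinAt hy)]
    exact hmono.derivWithin_nonneg
  refine le_on_closure (s := Ioi (0 : ℝ)) (f := fun _ => (0 : ℝ)) hpos continuousOn_const ?_ ?_
  · rwa [closure_Ioi]
  · rwa [closure_Ioi]

/-- The law of the inverse process. -/
theorem hasContinuousDensity_inverseProcess (hν0 : 0 < ν) (hν : ν < 1 / 2) (hlam : 0 < lam)
    (hH : IsIncreasingWithExponent (fun s => s ^ (2 * ν) + 2 * lam * s ^ ν) H P) {t : ℝ}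
    (ht : 0 < t) :
    HasContinuousDensity (inverseProcess H t) (fun x => inverseDensity ν lam x t) P := by
  have hΨ : 0 < (fun s : ℝ => s ^ (2 * ν) + 2 * lam * s ^ ν) 1 := exponent_pos hlam one_pos
  have hcont := continuousOn_inverseDensity_left hν0 hν hlam ht
  have hnn : ∀ x, 0 ≤ x → 0 ≤ inverseDensity ν lam x t := fun x hx =>
    inverseDensity_nonneg hν0 hν hlam hH hx ht
  have hL := hH.aemeasurable_inverseProcess hΨ ht
  refine ⟨hcont, hnn, hL, ?_⟩
  have : IsProbabilityMeasure (P.map (inverseProcess H t)) := Measure.isProbabilityMeasure_map hL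
  refine Measure.ext_of_Iic _ _ fun x => ?_
  rw [Measure.map_apply_of_aemeasurable hL measurableSet_Iic, withDensity_apply _ measurableSet_Iic,
    Measure.restrict_restrict measurableSet_Iic, inter_comm, Ici_inter_Iic]
  rcases lt_or_ge x 0 with hx | hx
  · rw [Icc_eq_empty (not_le.2 hx), Measure.restrict_empty, lintegral_zero_measure]
    convert measure_empty (μ := P)
    ext ω
    simp only [mem_preimage, mem_Iic, mem_empty_iff_false, iff_false, not_le]
    exact hx.trans_le inverseProcess_nonneg
  · have h1 := hH.measure_inverseProcess_le hΨ ht x.toNNReal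
    have h2 := integral_inverseDensity_eq hν0 hν hlam hH x.toNNReal ht
    rw [Real.coe_toNNReal x hx] at h1 h2
    change P {ω | inverseProcess H t ω ≤ x} = _
    rw [h1, ← ofReal_measureReal, ← h2, intervalIntegral.integral_of_le hx,
      ← integral_Icc_eq_integral_Ioc]
    refine ofReal_integral_eq_lintegral_ofReal ?_ ?_
    · exact (hcont.mono Icc_subset_Ici_self).integrableOn_Icc
    · exact (ae_restrict_mem measurableSet_Icc).mono fun y hy => hnn y hy.1

/-- The inverse process tends to `0` in law as `t ↓ 0`. -/
theorem tendsto_integral_mul_inverseDensity (hν0 : 0 < ν) (hν : ν < 1 / 2) (hlam : 0 < lam)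
    (hH : IsIncreasingWithExponent (fun s => s ^ (2 * ν) + 2 * lam * s ^ ν) H P) (φ : ℝ →ᵇ ℝ) :
    Tendsto (fun t => ∫ x in Ioi (0 : ℝ), φ x * inverseDensity ν lam x t) (𝓝[>] 0)
      (𝓝 (φ 0)) := by
  have hΨ : 0 < (fun s : ℝ => s ^ (2 * ν) + 2 * lam * s ^ ν) 1 := exponent_pos hlam one_pos
  have hcongr : ∀ t ∈ Ioi (0 : ℝ), ∫ x in Ioi (0 : ℝ), φ x * inverseDensity ν lam x t
      = ∫ ω, φ (inverseProcess H t ω) ∂P := fun t ht =>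
    ((hasContinuousDensity_inverseProcess hν0 hν hlam hH ht).integral_comp
      φ.continuous.measurable).2.symm
  have hlim : ∀ δ : ℝ≥0, 0 < δ → Tendsto (fun t => P.real {ω | δ < inverseProcess H t ω})
      (𝓝[>] 0) (𝓝 0) := by
    intro δ hδ
    -- Chernoff is used with `s = 1/t`: the exponent is at most `1 - 2λδ t^(-ν)`.
    have hexp : Tendsto (fun t : ℝ => Real.exp (t⁻¹ * t - δ * (2 * lam * t⁻¹ ^ ν))) (𝓝[>] 0)
        (𝓝 0) := by
      refine Real.tendsto_exp_atBot.comp ?_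
      have h1 : Tendsto (fun t : ℝ => δ * (2 * lam * t⁻¹ ^ ν)) (𝓝[>] 0) atTop :=
        (((tendsto_rpow_atTop hν0).comp tendsto_inv_nhdsGT_zero).const_mul_atTop
          (by linarith : 0 < 2 * lam)).const_mul_atTop hδ
      have h2 := tendsto_atBot_add_const_left (𝓝[>] (0 : ℝ)) (1 : ℝ)
        (tendsto_neg_atTop_atBot.comp h1)
      refine h2.congr' ?_
      filter_upwards [self_mem_nhdsWithin] with t ht
      rw [inv_mul_cancel₀ (ne_of_gt ht)]
      rfl
    refine squeeze_zero' (Eventually.of_forall fun t => measureReal_nonneg) ?_ hexp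
    filter_upwards [self_mem_nhdsWithin] with t ht
    have ht' : 0 < t := ht
    have hti : 0 < t⁻¹ := inv_pos.2 ht'
    calc P.real {ω | δ < inverseProcess H t ω} ≤ P.real {ω | H δ ω ≤ t} := by
          refine ENNReal.toReal_mono (measure_ne_top _ _) (measure_mono_ae ?_)
          filter_upwards [hH.ae_inverseProcess_le_iff hΨ] with ω hω hlt
          exact (not_le.1 fun h => absurd ((hω t ht δ).2 h) (not_le.2 hlt)).le
      _ ≤ Real.exp (t⁻¹ * t - δ * (t⁻¹ ^ (2 * ν) + 2 * lam * t⁻¹ ^ ν)) :=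
          hH.measureReal_le_le δ hti t
      _ ≤ Real.exp (t⁻¹ * t - δ * (2 * lam * t⁻¹ ^ ν)) := by
          gcongr
          have : 0 < t⁻¹ ^ (2 * ν) := Real.rpow_pos_of_pos hti _
          linarith
  rw [Metric.tendsto_nhds]
  intro ε hε
  obtain ⟨δ, hδ, hδφ⟩ := Metric.continuousAt_iff.1 (φ.continuous.continuousAt (x := 0)) (ε / 2)
    (by positivity)
  set δ' : ℝ≥0 := (δ / 2).toNNReal with hδ'
  have hδ'c : (δ' : ℝ) = δ / 2 := Real.coe_toNNReal _ (by positivity)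
  have hδ'0 : 0 < δ' := by rw [← NNReal.coe_pos, hδ'c]; positivity
  have hsmall : Tendsto (fun t => ε / 2 + 2 * ‖φ‖ * P.real {ω | δ' < inverseProcess H t ω})
      (𝓝[>] 0) (𝓝 (ε / 2 + 2 * ‖φ‖ * 0)) := ((hlim δ' hδ'0).const_mul _).const_add _
  rw [mul_zero, add_zero] at hsmall
  filter_upwards [self_mem_nhdsWithin, hsmall.eventually_lt_const (half_lt_self hε)] with t ht hlt
  rw [hcongr t ht, dist_eq_norm]
  refine lt_of_le_of_lt ?_ hlt
  have hL := hH.aemeasurable_inverseProcess hΨ ht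
  have hnull : NullMeasurableSet {ω | (δ' : ℝ) < inverseProcess H t ω} P :=
    hL.nullMeasurable measurableSet_Ioi
  have hφi : Integrable (fun ω => φ (inverseProcess H t ω)) P :=
    Integrable.of_bound (φ.continuous.measurable.comp_aemeasurable hL).aestronglyMeasurable ‖φ‖
      (Eventually.of_forall fun ω => φ.norm_coe_le_norm _)
  have hbi : Integrable (fun ω => ε / 2 + {ω | (δ' : ℝ) < inverseProcess H t ω}.indicator
      (fun _ => 2 * ‖φ‖) ω) P :=
    (integrable_const _).add ((integrable_const _).indicator₀ hnull)
  have hconst : φ 0 = ∫ _, φ 0 ∂P := by simp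
  calc ‖∫ ω, φ (inverseProcess H t ω) ∂P - φ 0‖
      = ‖∫ ω, (φ (inverseProcess H t ω) - φ 0) ∂P‖ := by
        rw [integral_sub hφi (integrable_const _), ← hconst]
    _ ≤ ∫ ω, (ε / 2 + {ω | (δ' : ℝ) < inverseProcess H t ω}.indicator
          (fun _ => 2 * ‖φ‖) ω) ∂P := by
        refine norm_integral_le_of_norm_le hbi (Eventually.of_forall fun ω => ?_)
        by_cases hω : (δ' : ℝ) < inverseProcess H t ω
        · rw [indicator_of_mem (by exact hω)]
          have := (norm_sub_le (φ (inverseProcess H t ω)) (φ 0)).trans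
            (add_le_add (φ.norm_coe_le_norm _) (φ.norm_coe_le_norm _))
          linarith
        · rw [indicator_of_notMem (by exact hω), add_zero, ← dist_eq_norm]
          refine (hδφ ?_).le
          rw [Real.dist_eq, sub_zero, abs_of_nonneg inverseProcess_nonneg]
          linarith [not_lt.1 hω]
    _ = ε / 2 + 2 * ‖φ‖ * P.real {ω | (δ' : ℝ) < inverseProcess H t ω} := by
        rw [integral_add (integrable_const _) ((integrable_const _).indicator₀ hnull),
          integral_indicator₀ hnull]
        simp [mul_comm]

/-- Double Laplace transform of the density. -/
lemma double_laplace_inverseDensity (hν0 : 0 < ν) (hν : ν < 1 / 2) (hlam : 0 < lam)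
    (hH : IsIncreasingWithExponent (fun s => s ^ (2 * ν) + 2 * lam * s ^ ν) H P) {γ s : ℝ}
    (hs : 0 < s) (hγ : 0 < s ^ (2 * ν) + 2 * lam * s ^ ν + γ) :
    Integrable (fun p : ℝ × ℝ => Real.exp (-γ * p.1)
      * (Real.exp (-s * p.2) * inverseDensity ν lam p.1 p.2))
      ((volume.restrict (Ioi (0 : ℝ))).prod (volume.restrict (Ioi (0 : ℝ)))) ∧
    ∫ x in Ioi (0 : ℝ), ∫ t in Ioi (0 : ℝ), Real.exp (-γ * x)
      * (Real.exp (-s * t) * inverseDensity ν lam x t)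
      = (s ^ (2 * ν) + 2 * lam * s ^ ν) / (s * (s ^ (2 * ν) + 2 * lam * s ^ ν + γ)) := by
  obtain ⟨-, hL⟩ := laplace_inverseDensity hν0 hν hlam hs
  set Ψ := s ^ (2 * ν) + 2 * lam * s ^ ν with hΨ
  have hinner : ∀ x ∈ Ioi (0 : ℝ), ∫ t in Ioi (0 : ℝ), Real.exp (-γ * x)
      * (Real.exp (-s * t) * inverseDensity ν lam x t)
      = Ψ / s * Real.exp (-(Ψ + γ) * x) := fun x hx => by
    rw [integral_const_mul, (hL x (le_of_lt hx)).2]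
    have : Real.exp (-(Ψ + γ) * x) = Real.exp (-γ * x) * Real.exp (-x * Ψ) := by
      rw [← Real.exp_add]; ring_nf
    rw [this]
    ring
  have hexp : IntegrableOn (fun x => Ψ / s * Real.exp (-(Ψ + γ) * x)) (Ioi 0) :=
    (exp_neg_integrableOn_Ioi 0 hγ).const_mul _
  constructor
  · rw [integrable_prod_iff]
    · refine ⟨?_, ?_⟩
      · filter_upwards [ae_restrict_mem measurableSet_Ioi] with x hx
        exact (hL x (le_of_lt hx)).1.const_mul _
      · refine hexp.congr ?_
        filter_upwards [ae_restrict_mem measurableSet_Ioi] with x hx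
        rw [← hinner x hx]
        refine setIntegral_congr_fun measurableSet_Ioi fun t ht => ?_
        -- Nonnegativity makes the norm integral equal to the integral already computed, so absolute
        -- convergence needs only `Ψ(s) + γ > 0`, even for negative `γ`.
        have := inverseDensity_nonneg hν0 hν hlam hH (le_of_lt hx) ht
        exact (Real.norm_of_nonneg (by positivity)).symm
    · exact (Continuous.aestronglyMeasurable (by fun_prop)).mul
        ((Continuous.aestronglyMeasurable (by fun_prop)).mul
          (aestronglyMeasurable_inverseDensity hν0 hν hlam measurableSet_Ioi Ioi_subset_Ici_self))
  · rw [setIntegral_congr_fun measurableSet_Ioi hinner, integral_const_mul,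
      integral_exp_mul_Ioi (neg_neg_of_pos hγ)]
    rw [mul_zero, Real.exp_zero, neg_div_neg_eq]
    field_simp

/-- The `x`-Laplace transform of the density. -/
theorem laplace_space_inverseDensity (hν0 : 0 < ν) (hν : ν < 1 / 2) (hlam : 0 < lam)
    (hH : IsIncreasingWithExponent (fun s => s ^ (2 * ν) + 2 * lam * s ^ ν) H P) {γ t : ℝ}
    (hγ : γ < lam ^ 2) (ht : 0 < t) :
    IntegrableOn (fun x => Real.exp (-γ * x) * inverseDensity ν lam x t) (Ioi 0) ∧
    ∫ x in Ioi (0 : ℝ), Real.exp (-γ * x) * inverseDensity ν lam x t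
      = mittagLefflerMixture ν lam γ t := by
  have hΨ : 0 < (fun s : ℝ => s ^ (2 * ν) + 2 * lam * s ^ ν) 1 := exponent_pos hlam one_pos
  have hcomp := fun t (ht : 0 < t) =>
    (hasContinuousDensity_inverseProcess hν0 hν hlam hH ht).integral_comp
      (g := fun x => Real.exp (-γ * x)) (by fun_prop)
  set D := √(lam ^ 2 - γ) with hD
  have hD0 : 0 < D := Real.sqrt_pos.2 (by linarith)
  have hD2 : D ^ 2 = lam ^ 2 - γ := Real.sq_sqrt (by linarith)
  -- For `s > s₀` one has `s^ν > λ + D`. This dominates both roots, and `Ψ(s) + γ = (s^ν + λ)² - D²`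
  -- is positive.
  set s₀ : ℝ := (lam + D) ^ (1 / ν) with hs₀
  have hs₀0 : 0 < s₀ := Real.rpow_pos_of_pos (by linarith) _
  have hbig : ∀ s, s₀ < s → lam + D < s ^ ν := fun s hs => by
    have := Real.rpow_lt_rpow hs₀0.le hs hν0
    rwa [hs₀, ← Real.rpow_mul (by linarith), one_div, inv_mul_cancel₀ hν0.ne',
      Real.rpow_one] at this
  have hpos : ∀ s, s₀ < s → 0 < s ^ (2 * ν) + 2 * lam * s ^ ν + γ := fun s hs => by
    have h1 := hbig s hs
    have h2 : s ^ (2 * ν) = s ^ ν * s ^ ν := by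
      rw [← Real.rpow_add (hs₀0.trans hs)]; ring_nf
    rw [h2]
    nlinarith
  have hdouble := fun s (hs : s₀ < s) =>
    double_laplace_inverseDensity hν0 hν hlam hH (hs₀0.trans hs) (hpos s hs)
  have hae_int : ∀ᵐ t ∂(volume.restrict (Ioi (0 : ℝ))),
      IntegrableOn (fun x => Real.exp (-γ * x) * inverseDensity ν lam x t) (Ioi 0) := by
    filter_upwards [(hdouble (s₀ + 1) (by linarith)).1.prod_left_ae] with t htt
    refine (htt.const_mul (Real.exp ((s₀ + 1) * t))).congr (Eventually.of_forall fun x => ?_)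
    have : Real.exp ((s₀ + 1) * t) * Real.exp (-(s₀ + 1) * t) = 1 := by
      rw [← Real.exp_add, neg_mul, add_neg_cancel, Real.exp_zero]
    simp only
    linear_combination (Real.exp (-γ * x) * inverseDensity ν lam x t) * this
  have hmonoL := hH.ae_monotone_inverseProcess hΨ
  have hmeas : ∀ t, 0 < t →
      AEStronglyMeasurable (fun ω => Real.exp (-γ * inverseProcess H t ω)) P := fun t ht =>
    ((by fun_prop : Measurable fun x : ℝ => Real.exp (-γ * x)).comp_aemeasurable
      (hH.aemeasurable_inverseProcess hΨ ht)).aestronglyMeasurable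
  have hint : ∀ t, 0 < t → Integrable (fun ω => Real.exp (-γ * inverseProcess H t ω)) P := by
    intro t ht
    rcases le_or_gt 0 γ with h0 | h0
    · refine Integrable.of_bound (hmeas t ht) 1 (Eventually.of_forall fun ω => ?_)
      rw [Real.norm_of_nonneg (Real.exp_pos _).le, Real.exp_le_one_iff]
      have := mul_nonneg h0 (inverseProcess_nonneg (H := H) (t := t) (ω := ω))
      linarith
    -- For `γ < 0`, finiteness at almost every time passes to each `t`: choose a good `t' > t` and
    -- use `L(t) ≤ L(t')`.
    · obtain ⟨t', ht', hi⟩ := exists_mem_Ioo_of_ae_restrict_Ioi hae_int ht.le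
        (lt_add_of_pos_right t one_pos)
      have ht'0 : 0 < t' := ht.trans ht'.1
      refine Integrable.mono' ((hcomp t' ht'0).1.2 hi) (hmeas t ht) ?_
      filter_upwards [hmonoL] with ω hω
      rw [Real.norm_of_nonneg (Real.exp_pos _).le, Real.exp_le_exp]
      exact mul_le_mul_of_nonneg_left (hω ht ht'0 ht'.1.le) (by linarith)
  refine ⟨(hcomp t ht).1.1 (hint t ht), ?_⟩
  have hae := ae_eq_of_laplace_eq (s₀ := s₀)
    (f := fun t => ∫ x in Ioi (0 : ℝ), Real.exp (-γ * x) * inverseDensity ν lam x t)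
    (g := mittagLefflerMixture ν lam γ) (fun s hs => ?_)
    (fun s hs => (laplace_mittagLefflerMixture hν0 hγ (hs₀0.trans hs) hlam (hbig s hs)).1)
    (fun s hs => ?_)
  · have hcont := continuousOn_mittagLefflerMixture hν0 lam γ
    -- The sign of `γ` decides whether `t ↦ 𝔼 exp(-γL(t))` is antitone or monotone; either suffices
    -- against the continuous mixture.
    rcases le_or_gt 0 γ with h0 | h0
    · refine AntitoneOn.eqOn_of_ae_eq_continuousOn (fun t ht t' ht' htt' => ?_) hcont hae ht
      rw [← (hcomp t ht).2, ← (hcomp t' ht').2]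
      refine integral_mono_ae (hint t' ht') (hint t ht) ?_
      filter_upwards [hmonoL] with ω hω
      rw [Real.exp_le_exp]
      exact mul_le_mul_of_nonpos_left (hω ht ht' htt') (by linarith)
    · refine MonotoneOn.eqOn_of_ae_eq_continuousOn (fun t ht t' ht' htt' => ?_) hcont hae ht
      rw [← (hcomp t ht).2, ← (hcomp t' ht').2]
      refine integral_mono_ae (hint t ht) (hint t' ht') ?_
      filter_upwards [hmonoL] with ω hω
      rw [Real.exp_le_exp]
      exact mul_le_mul_of_nonneg_left (hω ht ht' htt') (by linarith)
  · refine (hdouble s hs).1.integral_prod_right.congr (Eventually.of_forall fun t => ?_)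
    simp only
    rw [← integral_const_mul]
    congr 1
    funext x
    ring
  · rw [(laplace_mittagLefflerMixture hν0 hγ (hs₀0.trans hs) hlam (hbig s hs)).2,
      ← (hdouble s hs).2, integral_integral_swap (f := fun x t => Real.exp (-γ * x)
        * (Real.exp (-s * t) * inverseDensity ν lam x t)) (hdouble s hs).1]
    congr 1
    funext t
    rw [← integral_const_mul]
    congr 1
    funext x
    ring

end Law

theorem mainTheorem2 {Ω : Type*} [MeasurableSpace Ω] (P : Measure Ω) [IsProbabilityMeasure P]
    (ν lam : ℝ) (hν0 : 0 < ν) (hν : ν < 1 / 2) (hlam : 0 < lam)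
    (H₁ H₂ : ℝ≥0 → Ω → ℝ)
    (hH₁ : IsStableSubordinator (2 * ν) H₁ P) (hH₂ : IsStableSubordinator ν H₂ P)
    (hindep : IndepFun (fun ω t => H₁ t ω) (fun ω t => H₂ t ω) P) :
    ∃ l : ℝ → ℝ → ℝ,
      -- `l(·, t)` is the density of the inverse process at time `t`
      (∀ t, 0 < t →
        HasContinuousDensity (inverseProcess (sumProcess ν lam H₁ H₂) t) (fun x => l x t) P) ∧
      -- the time-fractional equation
      (∀ x t, 0 < x → 0 < t → ∃ a b d : ℝ,
        HasRLDerivAt (2 * ν) (fun s => l x s) a t ∧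
        HasRLDerivAt ν (fun s => l x s) b t ∧
        HasDerivAt (fun y => l y t) d x ∧
        a + 2 * lam * b = -d) ∧
      -- the initial condition `l(x, 0) = δ(x)`
      (∀ φ : ℝ →ᵇ ℝ,
        Tendsto (fun t => ∫ x in Ioi (0 : ℝ), φ x * l x t) (𝓝[>] 0) (𝓝 (φ 0))) ∧
      -- the boundary condition
      (∀ t, 0 < t →
        l 0 t = t ^ (-(2 * ν)) / Real.Gamma (1 - 2 * ν)
          + 2 * lam * (t ^ (-ν) / Real.Gamma (1 - ν))) ∧
      -- the `x`-Laplace transform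
      (∀ γ t, γ < lam ^ 2 → 0 < t →
        IntegrableOn (fun x => Real.exp (-γ * x) * l x t) (Ioi 0) ∧
        ∫ x in Ioi (0 : ℝ), Real.exp (-γ * x) * l x t =
          1 / 2 * ((1 + lam / √(lam ^ 2 - γ)) *
                mittagLeffler ν 1 ((-lam + √(lam ^ 2 - γ)) * t ^ ν)
            + (1 - lam / √(lam ^ 2 - γ)) *
                mittagLeffler ν 1 ((-lam - √(lam ^ 2 - γ)) * t ^ ν))) := by
  have hH := isIncreasingWithExponent_sumProcess hν0 hlam hH₁ hH₂ hindep
  exact ⟨inverseDensity ν lam,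
    fun t ht => hasContinuousDensity_inverseProcess hν0 hν hlam hH ht,
    fun x t hx ht => inverseDensity_fractional_equation hν0 hν hlam hx ht,
    tendsto_integral_mul_inverseDensity hν0 hν hlam hH,
    fun t ht => inverseDensity_zero hν0 hν ht,
    fun γ t hγ ht => laplace_space_inverseDensity hν0 hν hlam hH hγ ht⟩
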